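/- All rings are commutative with identity. Let $A$ be a ring, $N$ an $A$-module and $\mathbf{x}=x_1,\dots,x_\ell$ a finite sequence in $A$. The sequence $\mathbf{x}$ is \emph{weakly $N$-regular} if $x_i$ is a non-zero-divisor on $N/(x_1,\dots,x_{i-1})N$ for $i=1,\dots,\ell$, and \emph{$N$-regular} if moreover $\mathbf{x}N\neq N$. It is \emph{$N$-weakly proregular} if for every $n$ there is $m\ge n$ such that the natural maps of Koszul homology $H_i(x_1^m,\dots,x_\ell^m;N)\to H_i(x_1^n,\dots,x_\ell^n;N)$ are zero for all $i\ge 1$. It is a \emph{parameter sequence on $N$} if it is $N$-weakly proregular, $\mathbf{x}N\ne N$, and the top \v{C}ech cohomology satisfies $H^{\ell}_{\mathbf{x}}(N)_{\mathfrak p}\neq 0$ for every $\mathfrak p\in\operatorname{Supp}_A(N/\mathbf{x}N)$; it is a \emph{strong parameter sequence on $N$} if $x_1,\dots,x_i$ is a parameter sequence on $N$ for $i=1,\dots,\ell$. The $A$-module $N$ is \emph{Cohen-Macaulay} if every strong parameter sequence on $N$ is $N$-regular (the empty sequence being regarded as regular), and the ring $A$ is Cohen-Macaulay if it is so as an $A$-module.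 $N$ is \emph{maximal Cohen-Macaulay} if it is Cohen-Macaulay and $\dim N=\dim A$. The trivial extension $A\ltimes N$ is the ring with additive group $A\oplus N$ and multiplication $(a,u)(b,v)=(ab,av+bu)$. Let $R$ be a Noetherian local ring and $M$ a nonzero finitely generated $R$-module. Then the following statements are equivalent: \begin{enumerate} \item $R\ltimes M$ is Cohen-Macaulay; \item $R$ is Cohen-Macaulay and every $R$-regular sequence is an $M$-regular sequence; \item $R$ is Cohen-Macaulay and $M$ is maximal Cohen-Macaulay. \end{enumerate} -/

import Mathlib

noncomputable section

namespace TrivExtCM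

/-! ### Koszul complexes and weakly proregular sequences -/

section Koszul

variable {R : Type*} [CommRing R] (M : Type*) [AddCommGroup M] [Module R M] {l : ℕ}

/-- The degree `i` term of the Koszul complex on a sequence of length `l` with coefficients in `M`:
a direct sum of copies of `M` indexed by the `i`-element subsets of the index set. -/
abbrev KoszulChain (l i : ℕ) : Type _ := {s : Finset (Fin l) // s.card = i} → M

/-- The Koszul differential `K_{i+1}(x, M) → K_i(x, M)`: the basis vector `e_s ⊗ m` goes to
`∑_{j ∈ s} ± x_j e_{s \ {j}} ⊗ m`, where the sign is `(-1) ^ #{k ∈ s | k < j}`.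
Below it is written coordinate by coordinate, with `s = t ∪ {j}`. -/
def koszulD (x : Fin l → R) (i : ℕ) : KoszulChain M l (i + 1) →ₗ[R] KoszulChain M l i where
  toFun f t := ∑ j : Fin l, if h : j ∉ t.1 then
    ((-1 : R) ^ (t.1.filter (· < j)).card * x j) •
      f ⟨insert j t.1, by rw [Finset.card_insert_of_notMem h, t.2]⟩ else 0
  map_add' f g := by
    funext t
    simp only [Pi.add_apply, ← Finset.sum_add_distrib]
    refine Finset.sum_congr rfl fun j _ => ?_
    split_ifs <;> simp
  map_smul' r f := by
    funext t
    simp only [Pi.smul_apply, RingHom.id_apply, Finset.smul_sum]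
    refine Finset.sum_congr rfl fun j _ => ?_
    by_cases hj : j ∈ t.1
    · simp [hj]
    · simp only [hj, not_false_eq_true, dite_true]
      exact smul_comm _ _ _

/-- The degree `i` component of the chain map `K(x ^ m, M) → K(x ^ n, M)` (for `n ≤ m`), the tensor
product over `j` of the maps `K(x_j ^ m) → K(x_j ^ n)` which are the identity in degree `0` and
multiplication by `x_j ^ (m - n)` in degree `1`. -/
def koszulTrans (x : Fin l → R) (m n i : ℕ) : KoszulChain M l i →ₗ[R] KoszulChain M l i where
  toFun f s := (∏ j ∈ s.1, x j ^ (m - n)) • f s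
  map_add' f g := by funext s; simp
  map_smul' r f := by funext s; exact smul_comm _ _ _

/-- `x` is `M`-weakly proregular: for each `n` there is `m ≥ n` such that the induced maps
`H_i(x ^ m, M) → H_i(x ^ n, M)` vanish for all `i ≥ 1`, i.e. every cycle of positive degree is sent
to a boundary. (The degree `i ≥ 1` is written `i + 1`.) -/
def IsWeaklyProregular (x : Fin l → R) : Prop :=
  ∀ n : ℕ, ∃ m : ℕ, n ≤ m ∧ ∀ i : ℕ,
    ∀ z ∈ LinearMap.ker (koszulD M (fun j => x j ^ m) i),
      koszulTrans M x m n (i + 1) z ∈ LinearMap.range (koszulD M (fun j => x j ^ n) (i + 1))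

end Koszul

/-! ### Top Čech cohomology -/

section Cech

variable {R : Type*} [CommRing R] (M : Type*) [AddCommGroup M] [Module R M] {l : ℕ}

/-- The localization `M_{x_s}` of `M` at the product `x_s` of the elements `x_j`, `j ∈ s`. -/
abbrev CechTerm (x : Fin l → R) (s : Finset (Fin l)) : Type _ :=
  LocalizedModule (Submonoid.powers (∏ j ∈ s, x j)) M

lemma isUnit_cechTerm (x : Fin l → R) {s t : Finset (Fin l)} (h : s ⊆ t)
    (a : Submonoid.powers (∏ j ∈ s, x j)) :
    IsUnit (algebraMap R (Module.End R (CechTerm M x t)) a) := by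
  obtain ⟨_, k, rfl⟩ := a
  have hu : IsUnit (algebraMap R (Module.End R (CechTerm M x t)) (∏ j ∈ t, x j)) :=
    IsLocalizedModule.map_units (LocalizedModule.mkLinearMap _ M)
      (⟨_, Submonoid.mem_powers _⟩ : Submonoid.powers (∏ j ∈ t, x j))
  have he := congrArg (algebraMap R (Module.End R (CechTerm M x t))) (Finset.prod_sdiff (f := x) h)
  rw [map_mul] at he
  rw [← he] at hu
  have hc : Commute (algebraMap R (Module.End R (CechTerm M x t)) (∏ j ∈ t \ s, x j))
      (algebraMap R (Module.End R (CechTerm M x t)) (∏ j ∈ s, x j)) :=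
    Algebra.commutes _ _
  simpa using (hc.isUnit_mul_iff.mp hu).2.pow k

/-- The natural localization map `M_{x_s} → M_{x_t}` for `s ⊆ t`. -/
def cechMap (x : Fin l → R) {s t : Finset (Fin l)} (h : s ⊆ t) :
    CechTerm M x s →ₗ[R] CechTerm M x t :=
  LocalizedModule.lift _ (LocalizedModule.mkLinearMap _ M) (isUnit_cechTerm M x h)

/-- The top Čech cohomology `H^l_x(M)` of a sequence `x` of length `l`. The last differential of
the Čech complex is, up to signs of the components, the map
`⨁_j M_{x_1 ⋯ x_l / x_j} → M_{x_1 ⋯ x_l}` given by the localization maps, and the next term is `0`;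
so the top cohomology is the quotient by the sum of the images. -/
abbrev TopCech (x : Fin l → R) : Type _ :=
  CechTerm M x Finset.univ ⧸
    ⨆ j : Fin l, LinearMap.range (cechMap M x (Finset.subset_univ (Finset.univ.erase j)))

end Cech

/-! ### Parameter sequences and Cohen-Macaulay modules -/

section CM

variable (R : Type*) [CommRing R] (M : Type*) [AddCommGroup M] [Module R M]

/-- Parameter sequences on a module. -/
structure IsParameterSeq (rs : List R) : Prop where
  weaklyProregular : IsWeaklyProregular M rs.get
  smul_ne_top : Ideal.ofList rs • (⊤ : Submodule R M) ≠ ⊤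
  topCech_ne_zero : ∀ p ∈ Module.support R (M ⧸ (Ideal.ofList rs • ⊤ : Submodule R M)),
    Nontrivial (LocalizedModule p.asIdeal.primeCompl (TopCech M rs.get))

/-- Strong parameter sequences: every nonempty initial segment is a parameter sequence. -/
def IsStrongParameterSeq (rs : List R) : Prop :=
  ∀ i : ℕ, 1 ≤ i → i ≤ rs.length → IsParameterSeq R M (rs.take i)

/-- `M` is Cohen-Macaulay if every strong parameter sequence on `M` is `M`-regular; the empty
sequence counts as regular on every module, including the zero module. -/
def IsCohenMacaulay : Prop :=
  ∀ rs : List R, IsStrongParameterSeq R M rs → rs = [] ∨ RingTheory.Sequence.IsRegular M rs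

/-- `M` is maximal Cohen-Macaulay if it is Cohen-Macaulay and `dim M = dim R`. -/
def IsMaximalCohenMacaulay : Prop :=
  IsCohenMacaulay R M ∧ Module.supportDim R M = ringKrullDim R

end CM

end TrivExtCM

end

noncomputable section

open Pointwise

namespace TrivExtCM

/-! ### Top Čech cohomology as a direct limit of the quotients by powers -/

section Cech

variable {R : Type*} [CommRing R] (N : Type*) [AddCommGroup N] [Module R N]

/-! Write `A` for the trivial extension. Its ideal `M` has square zero and is the kernel of the
projection `A → R`.

Conditions 1 and 2. Over a Noetherian ring weak proregularity is automatic for finite modules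
(Artin–Rees), so a parameter sequence is governed by the top Čech cohomology, which is the direct
limit of the quotients `N / (x ^ t) N`. A square-zero kernel affects neither the primes nor the
vanishing of this limit, so strong parameter sequences pass from `R` to `A` and from `A` to `R`
(`isParameterSeq_map_inl`, `isParameterSeq_map_fst`). Weak regularity on `A` amounts to weak
regularity on both `R` and `M`, since `A` is an extension of `R` by `M`, split over `R`. As regular
sequences over a Noetherian local ring are strong parameter sequences, the equivalence follows.

Conditions 2 and 3. The definition of Cohen-Macaulay has to be compared with "depth equals
dimension". If `N` is Cohen-Macaulay, a regular sequence `rs` shorter than `dim N` is extended by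
some `y` outside the minimal primes of `N / rs N`. Then `rs, y` is a strong parameter sequence,
hence regular. This needs a case of Grothendieck nonvanishing, `exists_pow_smul_mem_of_vanishing`,
proved by finiteness arguments and Nakayama. Conversely, if depth equals dimension, the successive
quotients are unmixed. A zero-divisor `y` on one of them lies in a minimal prime of the annihilator
of that quotient, where the top Čech cohomology vanishes (`not_topNonzeroAt_append_singleton`). The
same bound on associated primes makes every `R`-regular sequence regular on a maximal Cohen-Macaulay
module. -/

lemma prod_pow_smul_mem {l : ℕ} (x : Fin l → R) {a : ℕ} (u : ℕ) {n : N}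
    (hn : n ∈ (Ideal.span (Set.range fun j => x j ^ a) • ⊤ : Submodule R N)) :
    (∏ j, x j) ^ u • n ∈ (Ideal.span (Set.range fun j => x j ^ (a + u)) • ⊤ : Submodule R N) := by
  suffices h : (Ideal.span (Set.range fun j => x j ^ a) • ⊤ : Submodule R N) ≤
      (Ideal.span (Set.range fun j => x j ^ (a + u)) • ⊤ : Submodule R N).comap
        (LinearMap.lsmul R N ((∏ j, x j) ^ u)) from h hn
  refine Submodule.smul_le.2 fun r hr m _ => ?_
  induction hr using Submodule.span_induction with
  | mem r hr =>
    obtain ⟨j, rfl⟩ := hr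
    simp only [Submodule.mem_comap, LinearMap.lsmul_apply]
    rw [← Finset.mul_prod_erase _ _ (Finset.mem_univ j), smul_smul, mul_pow, mul_assoc, mul_comm,
      mul_assoc, ← pow_add, mul_comm, mul_smul]
    exact Submodule.smul_mem_smul (Ideal.subset_span ⟨j, rfl⟩) trivial
  | zero => simp
  | add r s _ _ hr hs => rw [add_smul]; exact add_mem hr hs
  | smul a r _ hr => rw [smul_eq_mul, mul_smul]; exact Submodule.smul_mem _ _ hr

/-- The denominator `(x_1 ⋯ x_l) ^ t`. -/
abbrev prodPow {l : ℕ} (x : Fin l → R) (t : ℕ) : Submonoid.powers (∏ j, x j) :=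
  ⟨(∏ j, x j) ^ t, t, rfl⟩

/-- The map sending `m` to the class of `m / (x_1 ⋯ x_l) ^ t` in the top Čech cohomology. -/
def cechClass {l : ℕ} (x : Fin l → R) (t : ℕ) : N →ₗ[R] TopCech N x :=
  Submodule.mkQ _ ∘ₗ LocalizedModule.divBy (prodPow x t) ∘ₗ
    LocalizedModule.mkLinearMap _ N

variable {N}

lemma cechClass_apply {l : ℕ} (x : Fin l → R) (t : ℕ) (m : N) :
    cechClass N x t m = Submodule.Quotient.mk (LocalizedModule.mk m (prodPow x t)) := by
  simp only [cechClass, LinearMap.comp_apply, LocalizedModule.mkLinearMap_apply,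
    LocalizedModule.divBy_apply, LocalizedModule.liftOn_mk, one_mul, Submodule.mkQ_apply]

lemma cechClass_surjective {l : ℕ} (x : Fin l → R) (ξ : TopCech N x) :
    ∃ t m, cechClass N x t m = ξ := by
  obtain ⟨ξ, rfl⟩ := Submodule.mkQ_surjective _ ξ
  induction ξ using LocalizedModule.induction_on with
  | h m s =>
    obtain ⟨_, t, rfl⟩ := s
    exact ⟨t, m, cechClass_apply x t m⟩

lemma localizedModule_mk_pow_add {l : ℕ} (x : Fin l → R) (t u : ℕ) (m : N) :
    (LocalizedModule.mk ((∏ j, x j) ^ u • m) (prodPow x (t + u)) :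
      CechTerm N x Finset.univ) = LocalizedModule.mk m (prodPow x t) := by
  rw [LocalizedModule.mk_eq]
  refine ⟨1, ?_⟩
  simp only [one_smul, Submonoid.smul_def, smul_smul, pow_add]

lemma cechClass_add_pow {l : ℕ} (x : Fin l → R) (t u : ℕ) (m : N) :
    cechClass N x (t + u) ((∏ j, x j) ^ u • m) = cechClass N x t m := by
  rw [cechClass_apply, cechClass_apply, localizedModule_mk_pow_add]

lemma cechMap_mkLinearMap {l : ℕ} (x : Fin l → R) {s t : Finset (Fin l)} (h : s ⊆ t) (m : N) :
    cechMap N x h (LocalizedModule.mkLinearMap _ N m) = LocalizedModule.mkLinearMap _ N m := by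
  rw [cechMap, ← LinearMap.comp_apply, LocalizedModule.lift_comp]

lemma cechMap_erase_mk {l : ℕ} (x : Fin l → R) (j : Fin l) (t : ℕ) (m : N) :
    cechMap N x (Finset.subset_univ (Finset.univ.erase j))
      (LocalizedModule.mk m ⟨(∏ i ∈ Finset.univ.erase j, x i) ^ t, t, rfl⟩) =
      LocalizedModule.mk (x j ^ t • m) (prodPow x t) := by
  have hu := isUnit_cechTerm N x (Finset.subset_univ (Finset.univ.erase j))
    ⟨(∏ i ∈ Finset.univ.erase j, x i) ^ t, t, rfl⟩
  apply ((Module.End.isUnit_iff _).1 hu).1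
  simp only [Module.algebraMap_end_apply]
  rw [← map_smul, LocalizedModule.smul'_mk, LocalizedModule.smul'_mk, smul_smul, ← mul_pow,
    Finset.prod_erase_mul _ _ (Finset.mem_univ j)]
  have h1 : (LocalizedModule.mk ((∏ i ∈ Finset.univ.erase j, x i) ^ t • m)
      ⟨(∏ i ∈ Finset.univ.erase j, x i) ^ t, t, rfl⟩ : CechTerm N x (Finset.univ.erase j)) =
      LocalizedModule.mkLinearMap _ N m := by
    rw [LocalizedModule.mkLinearMap_apply, LocalizedModule.mk_eq]
    exact ⟨1, by simp [Submonoid.smul_def]⟩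
  have h2 : (LocalizedModule.mk ((∏ i, x i) ^ t • m)
      (prodPow x t) : CechTerm N x Finset.univ) =
      LocalizedModule.mkLinearMap _ N m := by
    rw [LocalizedModule.mkLinearMap_apply, LocalizedModule.mk_eq]
    exact ⟨1, by simp [Submonoid.smul_def]⟩
  rw [h1, h2]
  exact cechMap_mkLinearMap x _ m

/-- The top cohomology is the direct limit of `N / (x ^ t) N` along multiplication by the product of
the `x j`; a class vanishes exactly when it does so at some finite stage. -/
lemma cechClass_eq_zero_iff {l : ℕ} (x : Fin l → R) (t : ℕ) (m : N) :
    cechClass N x t m = 0 ↔ ∃ u, (∏ j, x j) ^ u • m ∈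
      (Ideal.span (Set.range fun j => x j ^ (t + u)) • ⊤ : Submodule R N) := by
  constructor
  · intro h
    rw [cechClass_apply, Submodule.Quotient.mk_eq_zero] at h
    -- Every coboundary is a fraction whose numerator lies in the ideal of powers with the same
    -- exponent as its denominator.
    have key : ∀ ξ ∈ ⨆ j : Fin l,
        LinearMap.range (cechMap N x (Finset.subset_univ (Finset.univ.erase j))),
        ∃ t, ∃ n ∈ (Ideal.span (Set.range fun j => x j ^ t) • ⊤ : Submodule R N),
          ξ = LocalizedModule.mk n (prodPow x t) := by
      intro ξ hξ
      induction hξ using Submodule.iSup_induction' with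
      | mem j ξ hξ =>
        obtain ⟨η, rfl⟩ := hξ
        induction η using LocalizedModule.induction_on with
        | h n s =>
          obtain ⟨_, t, rfl⟩ := s
          refine ⟨t, x j ^ t • n, Submodule.smul_mem_smul (Ideal.subset_span ⟨j, rfl⟩) trivial, ?_⟩
          exact cechMap_erase_mk x j t n
      | zero => exact ⟨0, 0, zero_mem _, by simp⟩
      | add ξ η _ _ hξ hη =>
        obtain ⟨a, n, hn, rfl⟩ := hξ
        obtain ⟨b, n', hn', rfl⟩ := hη
        refine ⟨a + b, (∏ j, x j) ^ b • n + (∏ j, x j) ^ a • n', add_mem ?_ ?_, ?_⟩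
        · exact prod_pow_smul_mem N x b hn
        · rw [add_comm a b]; exact prod_pow_smul_mem N x a hn'
        · rw [LocalizedModule.mk_add_mk]
          congr 1
          exact Subtype.ext (pow_add _ _ _).symm
    obtain ⟨t', n, hn, h⟩ := key _ h
    rw [LocalizedModule.mk_eq] at h
    obtain ⟨⟨_, v, rfl⟩, h⟩ := h
    simp only [Submonoid.smul_def, smul_smul, ← pow_add] at h
    refine ⟨v + t', ?_⟩
    rw [h, show t + (v + t') = t' + (v + t) by ring]
    exact prod_pow_smul_mem N x _ hn
  · rintro ⟨u, h⟩
    rw [← cechClass_add_pow x t u]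
    suffices h' : (Ideal.span (Set.range fun j => x j ^ (t + u)) • ⊤ : Submodule R N) ≤
        LinearMap.ker (cechClass N x (t + u)) from h' h
    refine Submodule.smul_le.2 fun r hr m _ => ?_
    induction hr using Submodule.span_induction with
    | mem r hr =>
      obtain ⟨j, rfl⟩ := hr
      rw [LinearMap.mem_ker, cechClass_apply, Submodule.Quotient.mk_eq_zero]
      refine Submodule.mem_iSup_of_mem j ⟨_, cechMap_erase_mk x j (t + u) m⟩
    | zero => simp
    | add r s _ _ hr hs => rw [add_smul]; exact add_mem hr hs
    | smul a r _ hr => rw [smul_eq_mul, mul_smul]; exact Submodule.smul_mem _ _ hr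

lemma ofList_map_pow_eq_span_range (rs : List R) (n : ℕ) :
    Ideal.ofList (rs.map (· ^ n)) = Ideal.span (Set.range fun j => rs.get j ^ n) := by
  refine congrArg Ideal.span (Set.ext fun r => ?_)
  change r ∈ rs.map (· ^ n) ↔ _
  simp only [List.mem_map, Set.mem_range]
  constructor
  · rintro ⟨a, ha, rfl⟩
    obtain ⟨i, rfl⟩ := List.get_of_mem ha
    exact ⟨i, rfl⟩
  · rintro ⟨i, rfl⟩
    exact ⟨_, List.get_mem rs i, rfl⟩

lemma prod_univ_list_get (rs : List R) : ∏ j, rs.get j = rs.prod :=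
  Fin.prod_univ_getElem rs

lemma listCechClass_eq_zero_iff (rs : List R) (t : ℕ) (m : N) :
    cechClass N rs.get t m = 0 ↔ ∃ u, rs.prod ^ u • m ∈
      (Ideal.ofList (rs.map (· ^ (t + u))) • ⊤ : Submodule R N) := by
  simp_rw [cechClass_eq_zero_iff, ofList_map_pow_eq_span_range, prod_univ_list_get]

lemma list_prod_pow_smul_mem (rs : List R) {a : ℕ} (u : ℕ) {n : N}
    (hn : n ∈ (Ideal.ofList (rs.map (· ^ a)) • ⊤ : Submodule R N)) :
    rs.prod ^ u • n ∈ (Ideal.ofList (rs.map (· ^ (a + u))) • ⊤ : Submodule R N) := by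
  rw [ofList_map_pow_eq_span_range] at hn ⊢
  rw [← prod_univ_list_get]
  exact prod_pow_smul_mem N _ u hn

variable (N) in
/-- An elementary form of the nonvanishing of the top Čech cohomology at a prime. -/
def TopNonzeroAt (rs : List R) (p : Ideal R) : Prop :=
  ∃ (t : ℕ) (m : N), ∀ s ∉ p, ∀ u, s • rs.prod ^ u • m ∉
    (Ideal.ofList (rs.map (· ^ (t + u))) • ⊤ : Submodule R N)

lemma nontrivial_localizedModule_topCech_iff (rs : List R) (p : Ideal R) [p.IsPrime] :
    Nontrivial (LocalizedModule p.primeCompl (TopCech N rs.get)) ↔ TopNonzeroAt N rs p := by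
  rw [← not_subsingleton_iff_nontrivial, LocalizedModule.subsingleton_iff]
  push Not
  constructor
  · rintro ⟨ξ, hξ⟩
    obtain ⟨t, m, rfl⟩ := cechClass_surjective _ ξ
    refine ⟨t, m, fun s hs u hu => hξ s hs ?_⟩
    rw [← map_smul, listCechClass_eq_zero_iff]
    exact ⟨u, by rwa [smul_comm]⟩
  · rintro ⟨t, m, h⟩
    refine ⟨cechClass N rs.get t m, fun s hs h0 => ?_⟩
    rw [← map_smul, listCechClass_eq_zero_iff] at h0
    obtain ⟨u, hu⟩ := h0
    exact h s hs u (by rwa [smul_comm])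

lemma TopNonzeroAt.mono {rs : List R} {p q : Ideal R} (h : TopNonzeroAt N rs p) (hpq : p ≤ q) :
    TopNonzeroAt N rs q := by
  obtain ⟨t, m, h⟩ := h
  exact ⟨t, m, fun s hs => h s fun hp => hs (hpq hp)⟩

end Cech

end TrivExtCM

namespace TrivExtCM

/-! ### Weak proregularity over Noetherian rings -/

section Koszul

variable {R : Type*} [CommRing R] {N : Type*} [AddCommGroup N] [Module R N] {l : ℕ}

lemma koszulD_apply (x : Fin l → R) (i : ℕ) (f : KoszulChain N l (i + 1))
    (t : {s : Finset (Fin l) // s.card = i}) :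
    koszulD N x i f t = ∑ j : Fin l, if h : j ∉ t.1 then
      ((-1 : R) ^ (t.1.filter (· < j)).card * x j) •
        f ⟨insert j t.1, by rw [Finset.card_insert_of_notMem h, t.2]⟩ else 0 := rfl

lemma koszulTrans_apply (x : Fin l → R) (m n i : ℕ) (f : KoszulChain N l i)
    (s : {s : Finset (Fin l) // s.card = i}) :
    koszulTrans N x m n i f s = (∏ j ∈ s.1, x j ^ (m - n)) • f s := rfl

lemma koszulD_koszulTrans (x : Fin l → R) {m n : ℕ} (hnm : n ≤ m) (i : ℕ)
    (f : KoszulChain N l (i + 1)) :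
    koszulD N (fun j => x j ^ n) i (koszulTrans N x m n (i + 1) f) =
      koszulTrans N x m n i (koszulD N (fun j => x j ^ m) i f) := by
  funext t
  rw [koszulD_apply, koszulTrans_apply, koszulD_apply, Finset.smul_sum]
  refine Finset.sum_congr rfl fun j _ => ?_
  by_cases hj : j ∈ t.1
  · simp [hj]
  · simp only [hj, not_false_eq_true, dite_true, koszulTrans_apply, smul_smul,
      Finset.prod_insert hj]
    congr 1
    rw [← Nat.add_sub_of_le hnm]
    simp only [Nat.add_sub_cancel_left, pow_add]
    ring

/-- The sign `(-1) ^ #{k ∈ t | k < j}` of the Koszul differential. -/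
def koszulSign (R : Type*) [CommRing R] (t : Finset (Fin l)) (j : Fin l) : R :=
  (-1) ^ (t.filter (· < j)).card

lemma koszulSign_mul_self (t : Finset (Fin l)) (j : Fin l) :
    koszulSign R t j * koszulSign R t j = 1 := by
  rw [koszulSign, ← mul_pow]; simp

lemma koszulSign_insert {t : Finset (Fin l)} {j k : Fin l} (hk : k ∉ t) :
    koszulSign R (insert k t) j = (if k < j then -1 else 1) * koszulSign R t j := by
  rw [koszulSign, koszulSign, Finset.filter_insert]
  split_ifs with h
  · rw [Finset.card_insert_of_notMem (by simp [hk]), pow_succ']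
  · rw [one_mul]

lemma koszulSign_swap {t : Finset (Fin l)} {j k : Fin l} (hj : j ∉ t) (hk : k ∉ t) (hjk : k ≠ j) :
    koszulSign R (insert j t) k * koszulSign R (insert k t) j +
      koszulSign R t j * koszulSign R t k = 0 := by
  rw [koszulSign_insert hj, koszulSign_insert hk]
  rcases lt_or_gt_of_ne hjk with h | h
  · rw [if_neg h.not_gt, if_pos h]; ring
  · rw [if_neg h.not_gt, if_pos h]; ring

/-- The Koszul homology is annihilated by the elements of the sequence. -/
lemma smul_mem_range_koszulD (x : Fin l → R) (i : ℕ) (j : Fin l) {z : KoszulChain N l (i + 1)}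
    (hz : koszulD N x i z = 0) : x j • z ∈ LinearMap.range (koszulD N x (i + 1)) := by
  classical
  -- Extending `z` by zero to all finite sets frees the computation from cardinality proofs.
  let Z : Finset (Fin l) → N := fun s => if h : s.card = i + 1 then z ⟨s, h⟩ else 0
  have hZ : ∀ s (h : s.card = i + 1), z ⟨s, h⟩ = Z s := fun s h => by simp [Z, h]
  -- This is `e_j ∧ z`; the identity behind the proof is `d (e_j ∧ z) + e_j ∧ d z = x_j z`.
  let b : KoszulChain N l (i + 1 + 1) := fun s =>
    if j ∈ s.1 then koszulSign R (s.1.erase j) j • Z (s.1.erase j) else 0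
  refine ⟨b, ?_⟩
  funext ⟨t, ht⟩
  rw [koszulD_apply, Pi.smul_apply, hZ]
  by_cases hj : j ∈ t
  · have hc : (t.erase j).card = i := by rw [Finset.card_erase_of_mem hj, ht]; rfl
    have h0 := congrFun hz ⟨t.erase j, hc⟩
    rw [koszulD_apply, Pi.zero_apply] at h0
    have h1 := congrArg (koszulSign R (t.erase j) j • ·) h0
    simp only [smul_zero, Finset.smul_sum] at h1
    -- Add the coordinate of `e_j ∧ d z` at `t`, which is zero. The terms with `k ≠ j` then cancel
    -- in pairs by `koszulSign_swap`.
    refine ((add_zero _).symm.trans (congrArg (_ + ·) h1.symm)).trans ?_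
    simp only
    rw [← Finset.sum_add_distrib, Finset.sum_eq_single j]
    · have h3 : koszulSign R (t.erase j) j * (koszulSign R (t.erase j) j * x j) = x j := by
        rw [← mul_assoc, koszulSign_mul_self, one_mul]
      simp only [hj, not_true_eq_false, dite_false, Finset.mem_erase, ne_eq,
        hZ, Finset.insert_erase hj, zero_add, false_and, not_false_eq_true, dite_true, smul_smul]
      exact congrArg (· • Z t) h3
    · intro k _ hkj
      by_cases hk : k ∈ t
      · simp [hk, hkj]
      · have hk' : k ∉ t.erase j := fun h => hk (Finset.mem_of_mem_erase h)
        have he : (insert k t).erase j = insert k (t.erase j) := Finset.erase_insert_of_ne hkj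
        have hs := koszulSign_swap (R := R) (Finset.notMem_erase j t) hk' hkj
        rw [Finset.insert_erase hj] at hs
        simp only [hk, hk', not_false_eq_true, dite_true, hZ, b, Finset.mem_insert, hj, or_true,
          if_true, he, smul_smul, ← add_smul]
        rw [show (0 : N) = (0 : R) • Z (insert k (t.erase j)) by simp]
        congr 1
        change koszulSign R t k * x k * _ + _ * (koszulSign R (t.erase j) k * x k) = 0
        linear_combination x k * hs
    · simp
  · rw [Finset.sum_eq_single j]
    · simp only [hj, not_false_eq_true, dite_true, b, Finset.mem_insert, true_or, if_true,
        Finset.erase_insert hj, smul_smul]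
      congr 1
      change koszulSign R t j * x j * _ = _
      linear_combination x j * koszulSign_mul_self (R := R) t j
    · intro k _ hkj
      simp [b, hj, Ne.symm hkj]
    · simp

lemma koszulTrans_mem_pow_smul_top (x : Fin l → R) (m n i : ℕ) (z : KoszulChain N l (i + 1)) :
    koszulTrans N x m n (i + 1) z ∈
      (Ideal.span (Set.range x) ^ (m - n) • ⊤ : Submodule R (KoszulChain N l (i + 1))) := by
  classical
  rw [← Finset.univ_sum_single (koszulTrans N x m n (i + 1) z)]
  refine Submodule.sum_mem _ fun s _ => ?_
  rw [koszulTrans_apply, Pi.single_smul]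
  refine Submodule.smul_mem_smul ?_ trivial
  -- Positive degree matters here: the product contains at least one factor `x j ^ (m - n)`.
  obtain ⟨j, hj⟩ : s.1.Nonempty := by rw [← Finset.card_pos, s.2]; omega
  rw [← Finset.mul_prod_erase _ _ hj]
  exact Ideal.mul_mem_right _ _ (Ideal.pow_mem_pow (Ideal.subset_span (Set.mem_range_self j)) _)

/-- The transition map sends cycles into `I ^ (m - n) K ∩ Z`. By Artin–Rees this lies in `I ^ (m - n
- c) Z`, hence in `J Z` for large `m`, and `J` annihilates the homology. -/
lemma exists_forall_koszulTrans_mem_range [IsNoetherianRing R] [Module.Finite R N]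
    (x : Fin l → R) (n i : ℕ) : ∃ m₀, ∀ m ≥ m₀, n ≤ m ∧
      ∀ z ∈ LinearMap.ker (koszulD N (fun j => x j ^ m) i),
        koszulTrans N x m n (i + 1) z ∈ LinearMap.range (koszulD N (fun j => x j ^ n) (i + 1)) := by
  set I := Ideal.span (Set.range x)
  set J := Ideal.span (Set.range fun j => x j ^ n)
  obtain ⟨a, ha⟩ : ∃ a, I ^ a ≤ J := by
    refine Ideal.exists_pow_le_of_le_radical_of_fg (Ideal.span_le.2 ?_) (IsNoetherian.noetherian I)
    rintro _ ⟨j, rfl⟩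
    exact ⟨n, Ideal.subset_span ⟨j, rfl⟩⟩
  set Z := LinearMap.ker (koszulD N (fun j => x j ^ n) i)
  obtain ⟨c, hc⟩ := Ideal.exists_pow_inf_eq_pow_smul I Z
  have hJ : J • Z ≤ LinearMap.range (koszulD N (fun j => x j ^ n) (i + 1)) := by
    refine Submodule.smul_le.2 fun r hr z hz => ?_
    induction hr using Submodule.span_induction with
    | mem r hr =>
      obtain ⟨j, rfl⟩ := hr
      exact smul_mem_range_koszulD (fun j => x j ^ n) i j hz
    | zero => simp
    | add r s _ _ hr hs => rw [add_smul]; exact add_mem hr hs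
    | smul a r _ hr => rw [smul_eq_mul, mul_smul]; exact Submodule.smul_mem _ _ hr
  refine ⟨n + (a + c), fun m hm => ⟨by omega, fun z hz => hJ ?_⟩⟩
  have h1 : koszulTrans N x m n (i + 1) z ∈ I ^ (m - n) • ⊤ ⊓ Z := by
    refine ⟨koszulTrans_mem_pow_smul_top x m n i z, ?_⟩
    change koszulD N _ i _ = 0
    rw [koszulD_koszulTrans x (by omega), LinearMap.mem_ker.1 hz, map_zero]
  rw [hc _ (by omega)] at h1
  refine Submodule.smul_mono ((Ideal.pow_le_pow_right ?_).trans ha) inf_le_right h1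
  omega

/-- Over a Noetherian ring every finite sequence is weakly proregular on every finite module. -/
theorem isWeaklyProregular_of_isNoetherianRing [IsNoetherianRing R] [Module.Finite R N]
    (x : Fin l → R) : IsWeaklyProregular N x := by
  intro n
  choose m₀ hm₀ using exists_forall_koszulTrans_mem_range (N := N) x n
  -- One `m` serves all degrees, because the complex vanishes above degree `l`.
  refine ⟨n + (Finset.range l).sup m₀, by omega, fun i z hz => ?_⟩
  by_cases hi : i < l
  · exact (hm₀ i _ ((Finset.le_sup (Finset.mem_range.2 hi)).trans (by omega))).2 z hz
  · have : IsEmpty {s : Finset (Fin l) // s.card = i + 1} :=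
      ⟨fun s => by have := s.1.card_le_univ; rw [s.2, Fintype.card_fin] at this; omega⟩
    rw [Subsingleton.elim (koszulTrans N x _ n (i + 1) z) 0]
    exact zero_mem _

end Koszul

variable {R : Type*} [CommRing R] [IsNoetherianRing R] {N : Type*} [AddCommGroup N] [Module R N]
  [Module.Finite R N]

lemma isParameterSeq_iff (rs : List R) :
    IsParameterSeq R N rs ↔ Ideal.ofList rs • (⊤ : Submodule R N) ≠ ⊤ ∧
      ∀ p ∈ Module.support R (N ⧸ (Ideal.ofList rs • ⊤ : Submodule R N)),
        TopNonzeroAt N rs p.asIdeal := by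
  simp_rw [← nontrivial_localizedModule_topCech_iff]
  exact ⟨fun h => ⟨h.2, h.3⟩, fun h => ⟨isWeaklyProregular_of_isNoetherianRing _, h.1, h.2⟩⟩

end TrivExtCM

namespace TrivExtCM

open RingTheory.Sequence Submodule

/-! ### Regular sequences: extensions, retracts and powers -/

section General

variable {R : Type*} [CommRing R]

lemma mk_mem_smul_top_iff {N : Type*} [AddCommGroup N] [Module R N] (L : Submodule R N)
    (J : Ideal R) (n : N) :
    (Submodule.Quotient.mk n : N ⧸ L) ∈ (J • ⊤ : Submodule R (N ⧸ L)) ↔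
      n ∈ L ⊔ (J • ⊤ : Submodule R N) := by
  have h : (J • ⊤ : Submodule R (N ⧸ L)) = (J • ⊤ : Submodule R N).map L.mkQ := by
    rw [Submodule.map_smul'', Submodule.map_top, Submodule.range_mkQ]
  rw [h, ← Submodule.mkQ_apply, ← Submodule.mem_comap, Submodule.comap_map_eq,
    Submodule.ker_mkQ, sup_comm]

lemma mem_ofList_cons_smul_top_iff {N : Type*} [AddCommGroup N] [Module R N] (r : R) (rs : List R)
    (n : N) : n ∈ (Ideal.ofList (r :: rs) • ⊤ : Submodule R N) ↔
      ∃ k, n - r • k ∈ (Ideal.ofList rs • ⊤ : Submodule R N) := by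
  rw [Ideal.ofList_cons_smul, Submodule.mem_sup]
  constructor
  · rintro ⟨_, ⟨k, _, rfl⟩, z, hz, rfl⟩
    exact ⟨k, by simpa using hz⟩
  · rintro ⟨k, hk⟩
    exact ⟨r • k, Submodule.smul_mem_pointwise_smul _ _ _ trivial, _, hk, by simp⟩

lemma mk_quotSMulTop_mem_iff {N : Type*} [AddCommGroup N] [Module R N] (r : R) (J : Ideal R)
    (n : N) :
    (Submodule.Quotient.mk n : QuotSMulTop r N) ∈ (J • ⊤ : Submodule R (QuotSMulTop r N)) ↔
      ∃ k, n - r • k ∈ (J • ⊤ : Submodule R N) := by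
  rw [mk_mem_smul_top_iff, Submodule.mem_sup]
  constructor
  · rintro ⟨_, ⟨k, _, rfl⟩, z, hz, rfl⟩
    exact ⟨k, by simpa using hz⟩
  · rintro ⟨k, hk⟩
    exact ⟨r • k, Submodule.smul_mem_pointwise_smul _ _ _ trivial, _, hk, by simp⟩

lemma mk_quotSMulTop_eq_zero_iff {N : Type*} [AddCommGroup N] [Module R N] (r : R) (n : N) :
    (Submodule.Quotient.mk n : QuotSMulTop r N) = 0 ↔ ∃ k, r • k = n := by
  rw [Submodule.Quotient.mk_eq_zero]
  constructor
  · rintro ⟨k, _, rfl⟩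
    exact ⟨k, rfl⟩
  · rintro ⟨k, rfl⟩
    exact Submodule.smul_mem_pointwise_smul _ _ _ trivial

/-- Weak regularity is inherited by extensions. -/
theorem isWeaklyRegular_of_exact {A B C : Type*} [AddCommGroup A] [Module R A] [AddCommGroup B]
    [Module R B] [AddCommGroup C] [Module R C] {f : A →ₗ[R] B} {g : B →ₗ[R] C}
    (hf : Function.Injective f) (hfg : Function.Exact f g) (hg : Function.Surjective g)
    {rs : List R} (hA : IsWeaklyRegular A rs) (hC : IsWeaklyRegular C rs) :
    IsWeaklyRegular B rs := by
  induction rs generalizing A B C with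
  | nil => exact .nil R B
  | cons r rs ih =>
    rw [isWeaklyRegular_cons_iff] at hA hC ⊢
    refine ⟨isSMulRegular_of_range_eq_ker hf (LinearMap.exact_iff.1 hfg).symm hA.1 hC.1,
      ih (f := QuotSMulTop.map r f) (g := QuotSMulTop.map r g) ?_
        (QuotSMulTop.map_exact r hfg hg) (QuotSMulTop.map_surjective r hg) hA.2 hC.2⟩
    -- Injectivity survives reduction modulo `r` because `r` is regular on `C`.
    rw [injective_iff_map_eq_zero]
    intro a ha
    obtain ⟨a, rfl⟩ := Submodule.mkQ_surjective _ a
    rw [Submodule.mkQ_apply] at ha ⊢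
    change (Submodule.Quotient.mk (f a) : QuotSMulTop r B) = 0 at ha
    rw [mk_quotSMulTop_eq_zero_iff] at ha ⊢
    obtain ⟨b, hb⟩ := ha
    have hgb : g b = 0 := by
      refine hC.1 ?_
      change r • g b = r • 0
      rw [← map_smul, hb, hfg.apply_apply_eq_zero, smul_zero]
    obtain ⟨a', rfl⟩ := (hfg b).1 hgb
    exact ⟨a', hf (by rw [map_smul, hb])⟩

/-- Weak regularity is inherited by direct summands. -/
theorem isWeaklyRegular_of_retract {A B : Type*} [AddCommGroup A] [Module R A] [AddCommGroup B]
    [Module R B] (f : A →ₗ[R] B) (g : B →ₗ[R] A) (hgf : ∀ a, g (f a) = a)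
    {rs : List R} (hB : IsWeaklyRegular B rs) : IsWeaklyRegular A rs := by
  induction rs generalizing A B with
  | nil => exact .nil R A
  | cons r rs ih =>
    rw [isWeaklyRegular_cons_iff] at hB ⊢
    refine ⟨hB.1.of_injective f (Function.LeftInverse.injective hgf),
      ih (QuotSMulTop.map r f) (QuotSMulTop.map r g) ?_ hB.2⟩
    intro a
    obtain ⟨a, rfl⟩ := Submodule.mkQ_surjective _ a
    change (Submodule.Quotient.mk (g (f a)) : QuotSMulTop r A) = Submodule.Quotient.mk a
    rw [hgf]

variable {N : Type*} [AddCommGroup N] [Module R N]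

/-- Induct along the exact sequence `0 → N / r ^ (a + 1) N → N / r ^ (a + 2) N → N / r N → 0`, whose
first map is multiplication by `r`. -/
lemma isWeaklyRegular_pow_cons {r : R} {rs : List R} (h : IsWeaklyRegular N (r :: rs)) (a : ℕ) :
    IsWeaklyRegular N (r ^ (a + 1) :: rs) := by
  induction a with
  | zero => simpa using h
  | succ a ih =>
    rw [isWeaklyRegular_cons_iff] at h ih ⊢
    refine ⟨h.1.pow _, ?_⟩
    let f : QuotSMulTop (r ^ (a + 1)) N →ₗ[R] QuotSMulTop (r ^ (a + 1 + 1)) N :=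
      Submodule.mapQ _ _ (LinearMap.lsmul R N r) (by
        rintro _ ⟨k, _, rfl⟩
        exact ⟨k, trivial, by
          simp only [DistribSMul.toLinearMap_apply, LinearMap.lsmul_apply]; module⟩)
    let g : QuotSMulTop (r ^ (a + 1 + 1)) N →ₗ[R] QuotSMulTop r N :=
      Submodule.mapQ _ _ LinearMap.id (by
        rintro _ ⟨k, _, rfl⟩
        exact ⟨r ^ (a + 1) • k, trivial, by
          simp only [DistribSMul.toLinearMap_apply, LinearMap.id_apply]; module⟩)
    refine isWeaklyRegular_of_exact (f := f) (g := g) ?_ ?_ ?_ ih.2 h.2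
    · rw [injective_iff_map_eq_zero]
      intro n hn
      obtain ⟨n, rfl⟩ := Submodule.mkQ_surjective _ n
      change (Submodule.Quotient.mk (r • n) : QuotSMulTop _ N) = 0 at hn
      rw [Submodule.mkQ_apply]
      rw [mk_quotSMulTop_eq_zero_iff] at hn ⊢
      obtain ⟨k, hk⟩ := hn
      refine ⟨k, h.1 ?_⟩
      change r • _ = r • n
      rw [← hk, smul_smul, pow_succ' r (a + 1)]
    · intro n
      obtain ⟨n, rfl⟩ := Submodule.mkQ_surjective _ n
      constructor
      · intro hn
        change (Submodule.Quotient.mk n : QuotSMulTop _ N) = 0 at hn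
        rw [mk_quotSMulTop_eq_zero_iff] at hn
        obtain ⟨k, rfl⟩ := hn
        exact ⟨Submodule.Quotient.mk k, rfl⟩
      · rintro ⟨k, hk⟩
        obtain ⟨k, rfl⟩ := Submodule.mkQ_surjective _ k
        rw [← hk]
        change (Submodule.Quotient.mk (r • k) : QuotSMulTop _ N) = 0
        rw [mk_quotSMulTop_eq_zero_iff]
        exact ⟨k, rfl⟩
    · intro n
      obtain ⟨n, rfl⟩ := Submodule.mkQ_surjective _ n
      exact ⟨Submodule.Quotient.mk n, rfl⟩

lemma isWeaklyRegular_map_pow {rs : List R} (h : IsWeaklyRegular N rs) (a : ℕ) :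
    IsWeaklyRegular N (rs.map (· ^ (a + 1))) := by
  induction rs generalizing N with
  | nil => exact .nil R N
  | cons r rs ih =>
    have h' := isWeaklyRegular_pow_cons h a
    rw [List.map_cons, isWeaklyRegular_cons_iff] at *
    exact ⟨h'.1, ih h'.2⟩

lemma mem_of_pow_smul_mem {r : R} {L : Submodule R N} (h : IsSMulRegular (N ⧸ L) r) (u : ℕ)
    {n : N} (hn : r ^ u • n ∈ L) : n ∈ L :=
  mem_of_isSMulRegular_quotient_of_smul_mem (h.pow u) hn

lemma isRegular_take {rs : List R} (h : IsRegular N rs) (i : ℕ) :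
    IsRegular N (rs.take i) := by
  refine ⟨?_, fun h' => h.top_ne_smul (le_antisymm ?_ le_top)⟩
  · have := h.toIsWeaklyRegular
    rw [← List.take_append_drop i rs, isWeaklyRegular_append_iff] at this
    exact this.1
  · conv_lhs => rw [h']
    exact Submodule.smul_mono_left (Ideal.span_mono fun a ha => List.mem_of_mem_take ha)

end General

/-! ### Regular sequences over a local ring are parameter sequences -/

section Local

variable {R : Type*} [CommRing R] [IsLocalRing R]
  {N : Type*} [AddCommGroup N] [Module R N]

open IsLocalRing

lemma mem_maximalIdeal_of_ofList_smul_ne_top {rs : List R}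
    (h : Ideal.ofList rs • (⊤ : Submodule R N) ≠ ⊤) : ∀ r ∈ rs, r ∈ maximalIdeal R := by
  intro r hr
  refine le_maximalIdeal (J := Ideal.ofList rs) (fun h' => h ?_) (Ideal.subset_span hr)
  rw [h', Submodule.top_smul]

variable [IsNoetherian R N]

/-- Regular sequences in the maximal ideal may be permuted, so `r` can be moved to the end. The
exponent `a + 1` is positive to keep the powers in the maximal ideal. -/
lemma isSMulRegular_quotient_pow {r : R} {rs : List R}
    (hm : ∀ a ∈ r :: rs, a ∈ maximalIdeal R) (h : IsWeaklyRegular N (r :: rs)) (a : ℕ) :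
    IsSMulRegular (N ⧸ (Ideal.ofList (rs.map (· ^ (a + 1))) • ⊤ : Submodule R N)) r := by
  have h1 : IsWeaklyRegular N (r :: rs.map (· ^ (a + 1))) := by
    rw [isWeaklyRegular_cons_iff] at h ⊢
    exact ⟨h.1, isWeaklyRegular_map_pow h.2 a⟩
  have h2 : IsWeaklyRegular N (rs.map (· ^ (a + 1)) ++ [r]) := by
    refine isWeaklyRegular_of_perm_of_subset_maximalIdeal h1
      (List.perm_append_singleton r _).symm ?_
    intro b hb
    rcases List.mem_cons.1 hb with rfl | hb
    · exact hm _ List.mem_cons_self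
    · obtain ⟨c, hc, rfl⟩ := List.mem_map.1 hb
      exact Ideal.pow_mem_of_mem _ (hm c (List.mem_cons_of_mem _ hc)) _ (Nat.succ_pos a)
  rw [isWeaklyRegular_append_iff, isWeaklyRegular_singleton_iff] at h2
  exact h2.2

/-- The maps `N / (x ^ t) N → H_x(N)` are injective for a regular sequence. -/
lemma mem_of_prod_pow_smul_mem {rs : List R} (hm : ∀ a ∈ rs, a ∈ maximalIdeal R)
    (h : IsWeaklyRegular N rs) (t u : ℕ) {n : N}
    (hn : rs.prod ^ u • n ∈ (Ideal.ofList (rs.map (· ^ (t + 1 + u))) • ⊤ : Submodule R N)) :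
    n ∈ (Ideal.ofList (rs.map (· ^ (t + 1))) • ⊤ : Submodule R N) := by
  induction rs generalizing N with
  | nil => simpa using hn
  | cons r rs ih =>
    rw [List.map_cons, mem_ofList_cons_smul_top_iff] at hn ⊢
    obtain ⟨k, hk⟩ := hn
    rw [← mk_quotSMulTop_mem_iff]
    refine ih (fun a ha => hm a (List.mem_cons_of_mem _ ha))
      ((isWeaklyRegular_cons_iff _ _ _).1 (isWeaklyRegular_pow_cons h t)).2 ?_
    rw [← Submodule.Quotient.mk_smul, mk_quotSMulTop_mem_iff]
    have hr : IsSMulRegular (N ⧸ (Ideal.ofList (rs.map (· ^ (t + 1 + u))) • ⊤ : Submodule R N)) r :=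
      (show t + 1 + u = t + u + 1 by ring) ▸ isSMulRegular_quotient_pow hm h (t + u)
    -- The factor `r ^ u` comes out of both terms and is cancelled modulo the powers of the
    -- remaining elements.
    refine ⟨k, mem_of_pow_smul_mem hr u ?_⟩
    convert hk using 1
    rw [List.prod_cons, smul_sub, smul_smul, smul_smul, ← mul_pow, ← pow_add, add_comm u]

/-- For a regular sequence the elements of `N / (x ^ (t + 1)) N` killed by the sequence are the
multiples of `(x_1 ⋯ x_l) ^ t`. -/
lemma exists_sub_prod_pow_smul_mem {rs : List R} (hm : ∀ a ∈ rs, a ∈ maximalIdeal R)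
    (h : IsWeaklyRegular N rs) (t : ℕ) {n : N}
    (hn : ∀ r ∈ rs, r • n ∈ (Ideal.ofList (rs.map (· ^ (t + 1))) • ⊤ : Submodule R N)) :
    ∃ n', n - rs.prod ^ t • n' ∈ (Ideal.ofList (rs.map (· ^ (t + 1))) • ⊤ : Submodule R N) := by
  induction rs generalizing N with
  | nil => exact ⟨n, by simp⟩
  | cons r rs ih =>
    have hr := isSMulRegular_quotient_pow hm h t
    obtain ⟨k, hk⟩ := (mem_ofList_cons_smul_top_iff _ _ _).1 (hn r List.mem_cons_self)
    have hk : n - r ^ t • k ∈ (Ideal.ofList (rs.map (· ^ (t + 1))) • ⊤ : Submodule R N) := by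
      refine mem_of_pow_smul_mem hr 1 ?_
      rw [pow_one, smul_sub, smul_smul, ← pow_succ']
      exact hk
    obtain ⟨k', hk'⟩ := ih (N := QuotSMulTop r N) (n := Submodule.Quotient.mk k)
      (fun a ha => hm a (List.mem_cons_of_mem _ ha)) ((isWeaklyRegular_cons_iff _ _ _).1 h).2 (by
        intro s hs
        rw [← Submodule.Quotient.mk_smul, mk_quotSMulTop_mem_iff]
        obtain ⟨j, hj⟩ := (mem_ofList_cons_smul_top_iff _ _ _).1
          (hn s (List.mem_cons_of_mem _ hs))
        refine ⟨j, mem_of_pow_smul_mem hr t ?_⟩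
        have := sub_mem hj (Submodule.smul_mem _ s hk)
        convert this using 1
        module)
    obtain ⟨k', rfl⟩ := Submodule.mkQ_surjective _ k'
    rw [Submodule.mkQ_apply, ← Submodule.Quotient.mk_smul, ← Submodule.Quotient.mk_sub,
      mk_quotSMulTop_mem_iff] at hk'
    obtain ⟨j, hj⟩ := hk'
    refine ⟨k', (mem_ofList_cons_smul_top_iff _ _ _).2 ⟨j, ?_⟩⟩
    have := add_mem hk (Submodule.smul_mem _ (r ^ t) hj)
    convert this using 1
    rw [List.prod_cons, mul_pow]
    module

/-- The stage `t = 1` embeds `N / rs N` in the top cohomology, so the support of the former lies in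
that of the latter. -/
lemma topNonzeroAt_of_isWeaklyRegular {rs : List R} (hm : ∀ a ∈ rs, a ∈ maximalIdeal R)
    (h : IsWeaklyRegular N rs) {p : PrimeSpectrum R}
    (hp : p ∈ Module.support R (N ⧸ (Ideal.ofList rs • ⊤ : Submodule R N))) :
    TopNonzeroAt N rs p.asIdeal := by
  rw [Module.mem_support_iff'] at hp
  obtain ⟨m, hm'⟩ := hp
  obtain ⟨m, rfl⟩ := Submodule.mkQ_surjective _ m
  refine ⟨1, m, fun s hs u hu => hm' s hs ?_⟩
  rw [smul_comm] at hu
  have := mem_of_prod_pow_smul_mem hm h 0 u (by rwa [zero_add])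
  rw [← map_smul, Submodule.mkQ_apply, Submodule.Quotient.mk_eq_zero]
  simpa using this

theorem isParameterSeq_of_isRegular [IsNoetherianRing R] [Module.Finite R N] {rs : List R}
    (h : IsRegular N rs) : IsParameterSeq R N rs := by
  rw [isParameterSeq_iff]
  have h0 : Ideal.ofList rs • (⊤ : Submodule R N) ≠ ⊤ := h.top_ne_smul.symm
  exact ⟨h0, fun p hp => topNonzeroAt_of_isWeaklyRegular
    (mem_maximalIdeal_of_ofList_smul_ne_top h0) h.toIsWeaklyRegular hp⟩

theorem isStrongParameterSeq_of_isRegular [IsNoetherianRing R] [Module.Finite R N] {rs : List R}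
    (h : IsRegular N rs) : IsStrongParameterSeq R N rs :=
  fun i _ _ => isParameterSeq_of_isRegular (isRegular_take h i)

end Local

end TrivExtCM

namespace TrivExtCM

universe u

variable {R : Type*} [CommRing R]

/-! ### Artinian and cofinite modules -/

section Artinian

variable {T : Type*} [AddCommGroup T] [Module R T]

/-- The part of `r ^ n • B` killed by `r`. -/
def leadingPart (r : R) (n : ℕ) (B : Submodule R T) : Submodule R (Submodule.torsionBy R T r) :=
  (B.map (LinearMap.lsmul R T (r ^ n))).comap (Submodule.subtype _)

lemma mem_leadingPart {r : R} {n : ℕ} {B : Submodule R T} {a : Submodule.torsionBy R T r} :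
    a ∈ leadingPart r n B ↔ ∃ b ∈ B, r ^ n • b = a := Iff.rfl

lemma leadingPart_mono (r : R) {m n : ℕ} (hmn : m ≤ n) {B B' : Submodule R T} (hB : B ≤ B') :
    leadingPart r n B ≤ leadingPart r m B' := by
  rintro a ⟨b, hb, h⟩
  refine ⟨r ^ (n - m) • b, B'.smul_mem _ (hB hb), ?_⟩
  rw [← h, LinearMap.lsmul_apply, LinearMap.lsmul_apply, smul_smul, ← pow_add,
    Nat.add_sub_of_le hmn]

/-- As with leading coefficients in Hilbert's basis theorem: subtracting an element of `B` with the
same leading part lowers the power of `r` needed to kill `b`. -/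
lemma le_of_leadingPart_le {r : R} (hr : ∀ t : T, ∃ n : ℕ, r ^ n • t = 0) {B B' : Submodule R T}
    (hB : B ≤ B') (h : ∀ n, leadingPart r n B' ≤ leadingPart r n B) : B' ≤ B := by
  suffices ∀ n, ∀ b ∈ B', r ^ n • b = 0 → b ∈ B by
    intro b hb
    obtain ⟨n, hn⟩ := hr b
    exact this n b hb hn
  intro n
  induction n with
  | zero =>
    intro b _ h0
    rw [pow_zero, one_smul] at h0
    exact h0 ▸ zero_mem B
  | succ n ih =>
    intro b hb h0
    have hb' : r ^ n • b ∈ Submodule.torsionBy R T r := by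
      rw [Submodule.mem_torsionBy_iff, smul_smul, ← pow_succ', h0]
    obtain ⟨c, hc, hcb⟩ := mem_leadingPart.1
      (h n (mem_leadingPart.2 ⟨b, hb, rfl⟩ : (⟨_, hb'⟩ : Submodule.torsionBy R T r) ∈ _))
    have := ih (b - c) (sub_mem hb (hB hc)) (by rw [smul_sub, hcb, sub_self])
    simpa using add_mem this hc

/-- A module all of whose elements are killed by powers of `r` is Artinian as soon as its
submodule of elements killed by `r` is. -/
theorem isArtinian_of_isArtinian_torsionBy {r : R} (hr : ∀ t : T, ∃ n : ℕ, r ^ n • t = 0)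
    [IsArtinian R (Submodule.torsionBy R T r)] : IsArtinian R T := by
  rw [← monotone_stabilizes_iff_artinian]
  intro f
  have hf : ∀ {i j}, i ≤ j → (OrderDual.ofDual (f j) : Submodule R T) ≤ OrderDual.ofDual (f i) :=
    fun h => f.monotone h
  have hst := monotone_stabilizes_iff_artinian (R := R) (M := Submodule.torsionBy R T r) |>.2 ‹_›
  -- The diagonal chain controls all `n ≥ a` at once; only the finitely many `n < a` need their own
  -- stabilization index.
  obtain ⟨a, ha⟩ := hst ⟨fun i => OrderDual.toDual (leadingPart r i (OrderDual.ofDual (f i))),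
    fun i j h => leadingPart_mono r h (hf h)⟩
  have hst' : ∀ n, ∃ k, ∀ m ≥ k, leadingPart r n (OrderDual.ofDual (f k)) =
      leadingPart r n (OrderDual.ofDual (f m)) := fun n =>
    hst ⟨fun i => OrderDual.toDual (leadingPart r n (OrderDual.ofDual (f i))),
      fun i j h => leadingPart_mono r le_rfl (hf h)⟩
  choose k hk using hst'
  have ha' : ∀ m ≥ a, leadingPart r a (OrderDual.ofDual (f a)) =
      leadingPart r m (OrderDual.ofDual (f m)) := ha
  refine ⟨a + (Finset.range a).sup k, fun m hm => ?_⟩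
  refine le_antisymm (f.monotone hm) (le_of_leadingPart_le hr (hf hm) fun n => ?_)
  by_cases hn : n < a
  · have h1 : k n ≤ (Finset.range a).sup k := Finset.le_sup (Finset.mem_range.2 hn)
    exact ((hk n _ (show a + (Finset.range a).sup k ≥ k n by omega)).symm.trans
      (hk n m (by omega))).le
  · calc _ ≤ leadingPart r a (OrderDual.ofDual (f a)) :=
          leadingPart_mono r (by omega) (hf (by omega))
      _ = leadingPart r (max n m) (OrderDual.ofDual (f (max n m))) := ha' _ (by omega)
      _ ≤ _ := leadingPart_mono r (by omega) (hf (by omega))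

/-- Fitting's lemma: the kernel and the range of a high power of `r` span `T`. -/
lemma exists_add_eq_of_isArtinian [IsArtinian R T] (r : R) :
    ∃ n, ∀ t : T, ∃ a b, r ^ n • a = 0 ∧ t = a + r • b := by
  obtain ⟨n, hn⟩ := Filter.eventually_atTop.1
    (LinearMap.eventually_codisjoint_ker_pow_range_pow (LinearMap.lsmul R T r))
  refine ⟨n + 1, fun t => ?_⟩
  have h := (hn (n + 1) (by omega)).eq_top
  obtain ⟨a, ha, b, ⟨c, rfl⟩, h⟩ := Submodule.mem_sup.1 (h ▸ Submodule.mem_top : t ∈ _)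
  have hpow : ∀ (m : ℕ) (t : T), (LinearMap.lsmul R T r ^ m) t = r ^ m • t := by
    intro m t
    induction m with
    | zero => simp
    | succ m ih =>
      rw [pow_succ', Module.End.mul_apply, ih, LinearMap.lsmul_apply, smul_smul, pow_succ']
  rw [LinearMap.mem_ker, hpow] at ha
  refine ⟨a, r ^ n • c, ha, ?_⟩
  rw [← h, hpow, smul_smul, pow_succ']

end Artinian

section Killed

variable (T : Type*) [AddCommGroup T] [Module R T]

/-- The submodule of elements killed by all members of a list. -/
def killedBy (rs : List R) : Submodule R T where
  carrier := {t | ∀ r ∈ rs, r • t = 0}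
  add_mem' ha hb r hr := by rw [smul_add, ha r hr, hb r hr, add_zero]
  zero_mem' r _ := smul_zero r
  smul_mem' a t ht r hr := by rw [smul_comm, ht r hr, smul_zero]

variable {T}

lemma mem_killedBy {rs : List R} {t : T} : t ∈ killedBy T rs ↔ ∀ r ∈ rs, r • t = 0 := Iff.rfl

lemma mem_killedBy_cons {r : R} {rs : List R} {t : T} :
    t ∈ killedBy T (r :: rs) ↔ r • t = 0 ∧ t ∈ killedBy T rs := by
  simp [mem_killedBy]

lemma map_mem_killedBy {U : Type*} [AddCommGroup U] [Module R U] (f : T →ₗ[R] U) {rs : List R}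
    {t : T} (ht : t ∈ killedBy T rs) : f t ∈ killedBy U rs := fun r hr => by
  rw [← map_smul, ht r hr, map_zero]

variable (T) in
/-- Every element is killed by powers of the members of `rs`, and the submodule killed by `rs` has
finite length. -/
structure IsCofinite (rs : List R) : Prop where
  torsion : ∀ r ∈ rs, ∀ t : T, ∃ n : ℕ, r ^ n • t = 0
  noeth : IsNoetherian R (killedBy T rs)
  art : IsArtinian R (killedBy T rs)

lemma isNoetherian_of_ker_le {X F Y : Type*} [AddCommGroup X] [Module R X] [AddCommGroup F]
    [Module R F] [AddCommGroup Y] [Module R Y] (f : X →ₗ[R] F) (g : X →ₗ[R] Y)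
    (hg : Function.Surjective g) (h : LinearMap.ker f ≤ LinearMap.ker g) [IsNoetherian R F] :
    IsNoetherian R Y := by
  have : IsNoetherian R (X ⧸ LinearMap.ker f) :=
    isNoetherian_of_linearEquiv f.quotKerEquivRange.symm
  refine isNoetherian_of_surjective ((LinearMap.ker f).liftQ g h) (LinearMap.range_eq_top.2 ?_)
  intro y
  obtain ⟨x, rfl⟩ := hg y
  exact ⟨Submodule.Quotient.mk x, rfl⟩

lemma isArtinian_of_ker_le {X F Y : Type*} [AddCommGroup X] [Module R X] [AddCommGroup F]
    [Module R F] [AddCommGroup Y] [Module R Y] (f : X →ₗ[R] F) (g : X →ₗ[R] Y)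
    (hg : Function.Surjective g) (h : LinearMap.ker f ≤ LinearMap.ker g) [IsArtinian R F] :
    IsArtinian R Y := by
  have : IsArtinian R (X ⧸ LinearMap.ker f) :=
    isArtinian_of_linearEquiv f.quotKerEquivRange.symm
  refine isArtinian_of_surjective _ ((LinearMap.ker f).liftQ g h) ?_
  intro y
  obtain ⟨x, rfl⟩ := hg y
  exact ⟨Submodule.Quotient.mk x, rfl⟩

/-- Multiplication by `r ^ n` maps the part killed by `r ^ (n + 1), rs` to the part killed by `r,
rs`, with kernel the part killed by `r ^ n, rs`. -/
lemma isNoetherian_isArtinian_killedBy_pow {r : R} {rs : List R} (h : IsCofinite T (r :: rs))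
    (n : ℕ) : IsNoetherian R (killedBy T (r ^ n :: rs)) ∧
      IsArtinian R (killedBy T (r ^ n :: rs)) := by
  induction n with
  | zero =>
    have : Subsingleton (killedBy T (r ^ 0 :: rs)) := by
      refine ⟨fun a b => Subtype.ext ?_⟩
      have h1 := (mem_killedBy_cons.1 a.2).1
      have h2 := (mem_killedBy_cons.1 b.2).1
      simp only [pow_zero, one_smul] at h1 h2
      rw [h1, h2]
    exact ⟨inferInstance, inferInstance⟩
  | succ n ih =>
    obtain ⟨h1, h2⟩ := ih
    have := h.noeth
    have := h.art
    have hle : killedBy T (r ^ n :: rs) ≤ killedBy T (r ^ (n + 1) :: rs) := fun t ht => by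
      rw [mem_killedBy_cons] at ht ⊢
      exact ⟨by rw [pow_succ', mul_smul, ht.1, smul_zero], ht.2⟩
    let g : killedBy T (r ^ (n + 1) :: rs) →ₗ[R] killedBy T (r :: rs) :=
      (LinearMap.lsmul R T (r ^ n)).restrict fun t ht => by
        rw [mem_killedBy_cons] at ht ⊢
        exact ⟨by rw [LinearMap.lsmul_apply, smul_smul, ← pow_succ', ht.1],
          Submodule.smul_mem _ _ ht.2⟩
    have hfg : LinearMap.range (Submodule.inclusion hle) = LinearMap.ker g := by
      rw [Submodule.range_inclusion]
      ext ⟨t, ht⟩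
      rw [LinearMap.mem_ker, Submodule.mem_comap, mem_killedBy_cons]
      exact ⟨fun h => Subtype.ext h.1,
        fun h => ⟨congrArg Subtype.val h, (mem_killedBy_cons.1 ht).2⟩⟩
    exact ⟨isNoetherian_of_range_eq_ker _ _ hfg, isArtinian_of_range_eq_ker _ _ hfg⟩

lemma IsCofinite.of_injective {U : Type*} [AddCommGroup U] [Module R U] {rs : List R}
    (h : IsCofinite T rs) (f : U →ₗ[R] T) (hf : Function.Injective f) : IsCofinite U rs where
  torsion r hr t := by
    obtain ⟨n, hn⟩ := h.torsion r hr (f t)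
    exact ⟨n, hf (by rw [map_smul, hn, map_zero])⟩
  noeth := by
    have := h.noeth
    exact isNoetherian_of_injective (f.restrict fun t ht => map_mem_killedBy f ht)
      fun a b hab => Subtype.ext (hf (congrArg Subtype.val hab))
  art := by
    have := h.art
    exact isArtinian_of_injective (f.restrict fun t ht => map_mem_killedBy f ht)
      fun a b hab => Subtype.ext (hf (congrArg Subtype.val hab))

lemma IsCofinite.of_injective_of_pow_smul_eq_zero {U : Type*} [AddCommGroup U] [Module R U] {r : R}
    {rs : List R} (h : IsCofinite T (r :: rs)) (f : U →ₗ[R] T) (hf : Function.Injective f)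
    (n : ℕ) (hn : ∀ t : U, r ^ n • t = 0) : IsCofinite U rs := by
  obtain ⟨_, _⟩ := isNoetherian_isArtinian_killedBy_pow h n
  let g : killedBy U rs →ₗ[R] killedBy T (r ^ n :: rs) := f.restrict fun t ht =>
    mem_killedBy_cons.2 ⟨by rw [← map_smul, hn, map_zero], map_mem_killedBy f ht⟩
  have hg : Function.Injective g := fun a b hab => Subtype.ext (hf (congrArg Subtype.val hab))
  refine ⟨fun s hs t => ?_, isNoetherian_of_injective g hg, isArtinian_of_injective g hg⟩
  obtain ⟨n, hn⟩ := h.torsion s (List.mem_cons_of_mem _ hs) (f t)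
  exact ⟨n, hf (by rw [map_smul, hn, map_zero])⟩

theorem IsCofinite.isArtinian {rs : List R} (h : IsCofinite T rs) : IsArtinian R T := by
  induction rs generalizing T with
  | nil =>
    have := h.art
    exact isArtinian_of_injective (LinearMap.codRestrict (killedBy T []) LinearMap.id
      fun t r hr => absurd hr List.not_mem_nil) fun a b hab => congrArg Subtype.val hab
  | cons r rs ih =>
    have := ih (h.of_injective_of_pow_smul_eq_zero (Submodule.subtype (Submodule.torsionBy R T r))
      (Submodule.subtype_injective _) 1 fun t => by
        rw [pow_one]; exact Submodule.smul_torsionBy r t)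
    exact isArtinian_of_isArtinian_torsionBy (h.torsion r List.mem_cons_self)

end Killed

/-- Elementary substitute for a long exact sequence: the obstruction to lifting an element of `C`
killed by `r` to one of `B` killed by `r` lives in `ker g / r ker g`. Since `ker g` is Artinian,
this quotient is again cofinite for the shorter list. -/
theorem killedBy_of_surjective (rs : List R) {B C : Type u} [AddCommGroup B] [Module R B]
    [AddCommGroup C] [Module R C] (g : B →ₗ[R] C) (hg : Function.Surjective g)
    (hA : IsCofinite (LinearMap.ker g) rs) :
    (IsNoetherian R (killedBy B rs) → IsNoetherian R (killedBy C rs)) ∧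
      (IsArtinian R (killedBy B rs) → IsArtinian R (killedBy C rs)) := by
  induction rs generalizing B C with
  | nil =>
    have hs : Function.Surjective (g.restrict (p := killedBy B []) (q := killedBy C [])
        fun t _ r hr => absurd hr List.not_mem_nil) := by
      rintro ⟨c, _⟩
      obtain ⟨b, rfl⟩ := hg c
      exact ⟨⟨b, fun r hr => absurd hr List.not_mem_nil⟩, rfl⟩
    exact ⟨fun _ => isNoetherian_of_surjective _ (LinearMap.range_eq_top.2 hs),
      fun _ => isArtinian_of_surjective _ _ hs⟩
  | cons r rs ih =>
    -- the quotient of `A = ker g` by `r` is cofinite for `rs`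
    have hQ : IsCofinite (QuotSMulTop r (LinearMap.ker g)) rs := by
      have := hA.isArtinian
      obtain ⟨n, hn⟩ := exists_add_eq_of_isArtinian (T := LinearMap.ker g) r
      let U := Submodule.torsionBy R (LinearMap.ker g) (r ^ n)
      have hU : IsCofinite U rs := hA.of_injective_of_pow_smul_eq_zero U.subtype
        U.subtype_injective n fun t => Submodule.smul_torsionBy (r ^ n) t
      let q : U →ₗ[R] QuotSMulTop r (LinearMap.ker g) := Submodule.mkQ _ ∘ₗ U.subtype
      have hq : Function.Surjective q := by
        intro c
        obtain ⟨t, rfl⟩ := Submodule.mkQ_surjective _ c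
        obtain ⟨a, b, ha, rfl⟩ := hn t
        refine ⟨⟨a, (Submodule.mem_torsionBy_iff _ _).2 ha⟩, ?_⟩
        change Submodule.Quotient.mk a = Submodule.Quotient.mk (a + r • b)
        rw [Submodule.Quotient.mk_add, (mk_quotSMulTop_eq_zero_iff r (r • b)).2 ⟨b, rfl⟩, add_zero]
      have h := ih q hq (hU.of_injective (LinearMap.ker q).subtype (Submodule.subtype_injective _))
      refine ⟨fun s hs c => ?_, h.1 hU.noeth, h.2 hU.art⟩
      obtain ⟨t, rfl⟩ := hq c
      obtain ⟨m, hm⟩ := hU.torsion s hs t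
      exact ⟨m, by rw [← map_smul, hm, map_zero]⟩
    -- the part of `C` coming from elements of `B` killed by `r`
    let B₁ := Submodule.torsionBy R B r
    let g₁ := (g ∘ₗ B₁.subtype).rangeRestrict
    have hB₁ : ∀ b : B₁, r • b = 0 := fun b => Submodule.smul_torsionBy r b
    have hk : IsCofinite (LinearMap.ker g₁) rs := by
      refine hA.of_injective_of_pow_smul_eq_zero
        (((B₁.subtype ∘ₗ (LinearMap.ker g₁).subtype)).codRestrict _ fun b => ?_) ?_ 1 ?_
      · exact congrArg Subtype.val b.2
      · intro a b hab
        have hab' := congrArg (fun z : LinearMap.ker g => (z : B)) hab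
        exact Subtype.ext (Subtype.ext hab')
      · intro b
        rw [pow_one]
        exact Subtype.ext (hB₁ b.1)
    have h1 := ih g₁ (LinearMap.surjective_rangeRestrict _) hk
    let C₁ := LinearMap.range (g ∘ₗ B₁.subtype)
    have hC₁ : ∀ c : C₁, r • c = 0 := by
      rintro ⟨_, b, rfl⟩
      refine Subtype.ext ?_
      change r • g b = 0
      rw [← map_smul, show r • (b : B) = 0 from congrArg Subtype.val (hB₁ b), map_zero]
    let j : killedBy C₁ rs →ₗ[R] killedBy C (r :: rs) := C₁.subtype.restrict fun c hc =>
      mem_killedBy_cons.2 ⟨congrArg Subtype.val (hC₁ c), map_mem_killedBy C₁.subtype hc⟩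
    let X := (killedBy C (r :: rs)).comap g
    let h : X →ₗ[R] killedBy C (r :: rs) ⧸ LinearMap.range j :=
      Submodule.mkQ _ ∘ₗ g.restrict fun _ hx => hx
    have hh : Function.Surjective h := by
      intro c
      obtain ⟨⟨c, hc⟩, rfl⟩ := Submodule.mkQ_surjective _ c
      obtain ⟨b, rfl⟩ := hg c
      exact ⟨⟨b, hc⟩, rfl⟩
    have hX : ∀ (b : X), ∀ s ∈ r :: rs, g (s • (b : B)) = 0 := fun b s hs => by
      rw [map_smul]; exact b.2 s hs
    -- The connecting map of the snake lemma, `b ↦ r b` modulo `r ker g`; an element in its kernel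
    -- can be corrected by `ker g` to be killed by `r`.
    let φ : X →ₗ[R] LinearMap.ker g := (LinearMap.lsmul R B r ∘ₗ X.subtype).codRestrict _
      fun b => hX b r List.mem_cons_self
    let ψ : X →ₗ[R] killedBy (QuotSMulTop r (LinearMap.ker g)) rs :=
      (Submodule.mkQ _ ∘ₗ φ).codRestrict _ fun b s hs => by
        rw [← map_smul]
        refine (mk_quotSMulTop_eq_zero_iff _ _).2
          ⟨⟨s • (b : B), hX b s (List.mem_cons_of_mem _ hs)⟩, Subtype.ext ?_⟩
        change r • s • (b : B) = r • ((s • b : X) : B)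
        rfl
    have hker : LinearMap.ker ψ ≤ LinearMap.ker h := by
      intro b hb
      have hb' : (Submodule.Quotient.mk (φ b) : QuotSMulTop r (LinearMap.ker g)) = 0 :=
        congrArg Subtype.val (LinearMap.mem_ker.1 hb)
      obtain ⟨a, ha⟩ := (mk_quotSMulTop_eq_zero_iff _ _).1 hb'
      have ha' : r • (a : B) = r • (b : B) := congrArg Subtype.val ha
      have hga : g (a : B) = 0 := a.2
      refine LinearMap.mem_ker.2 ((Submodule.Quotient.mk_eq_zero _).2 ?_)
      have hba : (b : B) - a ∈ B₁ := by
        rw [Submodule.mem_torsionBy_iff, smul_sub, ha', sub_self]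
      have hgb : g ((b : B) - a) = g b := by rw [map_sub, hga, sub_zero]
      refine ⟨⟨⟨g b, ⟨_, hba⟩, hgb⟩, fun s hs => Subtype.ext ?_⟩, rfl⟩
      change s • g b = 0
      rw [← map_smul]
      exact hX b s (List.mem_cons_of_mem _ hs)
    have hjr : LinearMap.range j = LinearMap.ker (Submodule.mkQ (LinearMap.range j)) :=
      (Submodule.ker_mkQ _).symm
    let e : killedBy B₁ rs →ₗ[R] killedBy B (r :: rs) := B₁.subtype.restrict fun b hb =>
      mem_killedBy_cons.2 ⟨congrArg Subtype.val (hB₁ b), map_mem_killedBy B₁.subtype hb⟩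
    have he : Function.Injective e := fun a b hab => by
      have hab' := congrArg (fun z : killedBy B (r :: rs) => (z : B)) hab
      exact Subtype.ext (Subtype.ext hab')
    refine ⟨fun _ => ?_, fun _ => ?_⟩
    · have := h1.1 (isNoetherian_of_injective e he)
      have := hQ.noeth
      have := isNoetherian_of_ker_le ψ h hh hker
      exact isNoetherian_of_range_eq_ker _ _ hjr
    · have := h1.2 (isArtinian_of_injective e he)
      have := hQ.art
      have := isArtinian_of_ker_le ψ h hh hker
      exact isArtinian_of_range_eq_ker _ _ hjr

end TrivExtCM

namespace TrivExtCM

open RingTheory.Sequence IsLocalRing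

section Artinian

variable {R : Type*} [CommRing R]

/-- The submodule of elements killed by a power of `y`. -/
def powTorsion (y : R) (E : Type*) [AddCommGroup E] [Module R E] : Submodule R E where
  carrier := {e | ∃ n : ℕ, y ^ n • e = 0}
  add_mem' := by
    rintro a b ⟨m, hm⟩ ⟨n, hn⟩
    refine ⟨m + n, ?_⟩
    rw [smul_add, pow_add, mul_smul, mul_smul, hn, smul_zero, smul_comm, hm, smul_zero, add_zero]
  zero_mem' := ⟨0, smul_zero _⟩
  smul_mem' := by
    rintro c a ⟨n, hn⟩
    exact ⟨n, by rw [smul_comm, hn, smul_zero]⟩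

lemma mem_powTorsion_of_smul_mem {y : R} {E : Type*} [AddCommGroup E] [Module R E] {e : E}
    (h : y • e ∈ powTorsion y E) : e ∈ powTorsion y E := by
  obtain ⟨n, hn⟩ := h
  exact ⟨n + 1, by rw [pow_succ, mul_smul, hn]⟩

lemma isArtinian_of_finite_of_annihilated {V : Type*} [AddCommGroup V] [Module R V]
    [Module.Finite R V] (J : Ideal R) [IsArtinianRing (R ⧸ J)] (hJ : ∀ a ∈ J, ∀ v : V, a • v = 0) :
    IsArtinian R V := by
  obtain ⟨n, g, hg⟩ := Module.Finite.exists_fin' R V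
  have h1 : IsArtinian R (R ⧸ J) :=
    isArtinian_of_surjective_algebraMap (Ideal.Quotient.mk_surjective (I := J))
  let f : (Fin n → R) →ₗ[R] (Fin n → R ⧸ J) := LinearMap.pi fun i => J.mkQ ∘ₗ LinearMap.proj i
  refine isArtinian_of_ker_le f g hg fun v hv => ?_
  have hv' : ∀ i, v i ∈ J := fun i => by
    have := congrFun (LinearMap.mem_ker.1 hv) i
    exact (Submodule.Quotient.mk_eq_zero J).1 this
  rw [LinearMap.mem_ker, ← Finset.univ_sum_single v, map_sum]
  refine Finset.sum_eq_zero fun i _ => ?_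
  rw [← mul_one (v i), ← smul_eq_mul, Pi.single_smul, map_smul]
  exact hJ _ (hv' i) _

lemma isArtinian_of_powTorsion {G : Type*} [AddCommGroup G] [Module R G] [IsNoetherian R G] {y : R}
    (hy : ∀ g : G, ∃ n : ℕ, y ^ n • g = 0) (J : Ideal R) [IsArtinianRing (R ⧸ J)]
    (hJ : ∀ g : G, y • g = 0 → J ≤ Ideal.torsionOf R G g) : IsArtinian R G := by
  have : IsArtinian R (Submodule.torsionBy R G y) :=
    isArtinian_of_finite_of_annihilated J fun a ha g =>
      Subtype.ext (hJ g.1 ((Submodule.mem_torsionBy_iff _ _).1 g.2) ha)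
  exact isArtinian_of_isArtinian_torsionBy hy

lemma isArtinianRing_quotient_of_forall_prime [IsNoetherianRing R] [IsLocalRing R] {J : Ideal R}
    (hJ : ∀ q : Ideal R, q.IsPrime → J ≤ q → q = maximalIdeal R) : IsArtinianRing (R ⧸ J) := by
  rw [isArtinianRing_iff_isNoetherianRing_krullDimLE_zero]
  refine ⟨inferInstance, Ring.KrullDimLE.mk₀ fun I hI => ?_⟩
  have h1 := hJ (I.comap (Ideal.Quotient.mk J)) (hI.comap _) (by
    intro a ha
    rw [Ideal.mem_comap, Ideal.Quotient.eq_zero_iff_mem.2 ha]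
    exact zero_mem I)
  have h2 : (I.comap (Ideal.Quotient.mk J)).IsMaximal := h1 ▸ inferInstance
  have := Ideal.map_eq_top_or_isMaximal_of_surjective _ (Ideal.Quotient.mk_surjective (I := J)) h2
  rw [Ideal.map_comap_of_surjective _ Ideal.Quotient.mk_surjective] at this
  exact this.resolve_left hI.ne_top

end Artinian

/-! ### Nonvanishing of the top Čech cohomology of a system of parameters -/

section Nonvanishing

variable {R : Type*} [CommRing R] {N : Type*} [AddCommGroup N] [Module R N]

lemma cechClass_smul_of_mem_killed (rs : List R) {r : R} (hr : r ∈ rs) (n : N) :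
    r • cechClass N rs.get 1 n = 0 := by
  rw [← map_smul, listCechClass_eq_zero_iff]
  refine ⟨0, ?_⟩
  rw [pow_zero, one_smul]
  refine Submodule.smul_mem_smul (Ideal.subset_span ?_) trivial
  exact List.mem_map.2 ⟨r, hr, by simp⟩

variable [IsLocalRing R] [IsNoetherianRing R] [Module.Finite R N]

lemma mem_of_cechClass_eq_zero {rs : List R} (hm : ∀ a ∈ rs, a ∈ maximalIdeal R)
    (h : IsWeaklyRegular N rs) {t : ℕ} {n : N} (hn : cechClass N rs.get (t + 1) n = 0) :
    n ∈ (Ideal.ofList (rs.map (· ^ (t + 1))) • ⊤ : Submodule R N) := by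
  obtain ⟨u, hu⟩ := (listCechClass_eq_zero_iff _ _ _).1 hn
  exact mem_of_prod_pow_smul_mem hm h t u hu

lemma exists_cechClass_one_eq {rs : List R} (hm : ∀ a ∈ rs, a ∈ maximalIdeal R)
    (h : IsWeaklyRegular N rs) {e : TopCech N rs.get}
    (he : e ∈ killedBy (TopCech N rs.get) rs) : ∃ n, cechClass N rs.get 1 n = e := by
  obtain ⟨t, m, rfl⟩ := cechClass_surjective _ e
  -- Enlarging the denominator makes the exponent positive, as the injectivity of the limit maps
  -- requires.
  rw [← cechClass_add_pow rs.get t 1 m] at he ⊢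
  obtain ⟨n, hn⟩ := exists_sub_prod_pow_smul_mem hm h t (n := (∏ j, rs.get j) ^ 1 • m)
    fun r hr => mem_of_cechClass_eq_zero hm h (by rw [map_smul]; exact he r hr)
  refine ⟨n, ?_⟩
  rw [← cechClass_add_pow rs.get 1 t n, add_comm 1 t, ← sub_eq_zero, ← neg_eq_zero, neg_sub,
    ← map_sub, listCechClass_eq_zero_iff, prod_univ_list_get]
  rw [prod_univ_list_get] at hn
  exact ⟨0, by simpa using hn⟩

/-- The killed part is contained in the image of `N` at stage one, which is a finite module. -/
lemma isNoetherian_killedBy_topCech {rs : List R} (hm : ∀ a ∈ rs, a ∈ maximalIdeal R)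
    (h : IsWeaklyRegular N rs) : IsNoetherian R (killedBy (TopCech N rs.get) rs) := by
  have hle : killedBy (TopCech N rs.get) rs ≤ LinearMap.range (cechClass N rs.get 1) :=
    fun e he => exists_cechClass_one_eq hm h he
  exact isNoetherian_of_injective (Submodule.inclusion hle) (Submodule.inclusion_injective hle)

lemma isCofinite_powTorsion {E : Type*} [AddCommGroup E] [Module R E] {rs : List R} {y : R}
    (htor : ∀ r ∈ rs, ∀ e : E, ∃ n : ℕ, r ^ n • e = 0) (hN : IsNoetherian R (killedBy E rs))
    {I : Ideal R} (hI : ∀ a ∈ I, ∀ e : E, a • e = 0)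
    (hJ : ∀ q : Ideal R, q.IsPrime → I ⊔ Ideal.ofList (rs ++ [y]) ≤ q → q = maximalIdeal R) :
    IsCofinite (powTorsion y E) rs := by
  have hN' : IsNoetherian R (killedBy (powTorsion y E) rs) := isNoetherian_of_injective
    ((powTorsion y E).subtype.restrict fun t ht => map_mem_killedBy (powTorsion y E).subtype ht :
      killedBy (powTorsion y E) rs →ₗ[R] killedBy E rs)
    fun a b hab => Subtype.ext (Subtype.ext (by
      exact congrArg (fun z : killedBy E rs => (z : E)) hab))
  have := isArtinianRing_quotient_of_forall_prime hJ
  refine ⟨fun r hr t => ?_, hN', isArtinian_of_powTorsion (y := y) ?_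
    (I ⊔ Ideal.ofList (rs ++ [y])) fun v hv =>
      sup_le (fun a ha => (Ideal.mem_torsionOf_iff _ _).2 ?_)
        (Ideal.span_le.2 fun a ha => (Ideal.mem_torsionOf_iff _ _).2 ?_)⟩
  · obtain ⟨n, hn⟩ := htor r hr t
    exact ⟨n, Subtype.ext hn⟩
  · rintro ⟨⟨t, n, hn⟩, _⟩
    exact ⟨n, Subtype.ext (Subtype.ext hn)⟩
  · exact Subtype.ext (Subtype.ext (hI a ha _))
  · rcases List.mem_append.1 ha with ha | ha
    · exact Subtype.ext (v.2 a ha)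
    · rw [List.mem_singleton.1 ha]
      exact hv

lemma isCofinite_powTorsion_topCech {rs : List R} {y : R} (hm : ∀ a ∈ rs, a ∈ maximalIdeal R)
    (h : IsWeaklyRegular N rs)
    (hJ : ∀ q : Ideal R, q.IsPrime → Module.annihilator R N ⊔ Ideal.ofList (rs ++ [y]) ≤ q →
      q = maximalIdeal R) :
    IsCofinite (powTorsion y (TopCech N rs.get)) rs := by
  refine isCofinite_powTorsion (fun r hr e => ?_) (isNoetherian_killedBy_topCech hm h)
    (fun a ha e => ?_) hJ
  · obtain ⟨k, m, rfl⟩ := cechClass_surjective _ e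
    refine ⟨k, ?_⟩
    rw [← map_smul, listCechClass_eq_zero_iff]
    refine ⟨0, ?_⟩
    rw [pow_zero, one_smul]
    exact Submodule.smul_mem_smul (Ideal.subset_span (List.mem_map.2 ⟨r, hr, rfl⟩)) trivial
  · obtain ⟨k, m, rfl⟩ := cechClass_surjective _ e
    rw [← map_smul, Module.mem_annihilator.1 ha, map_zero]

/-- If the top Čech cohomology of the sequence `rs, y` vanishes, where `rs` is regular and `rs, y`
is a system of parameters of `N`, then `y` is nilpotent on `N / rs N`. -/
theorem exists_pow_smul_mem_of_vanishing {rs : List R} {y : R}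
    (hm : ∀ a ∈ rs, a ∈ maximalIdeal R) (hy : y ∈ maximalIdeal R) (h : IsWeaklyRegular N rs)
    (hJ : ∀ q : Ideal R, q.IsPrime → Module.annihilator R N ⊔ Ideal.ofList (rs ++ [y]) ≤ q →
      q = maximalIdeal R)
    (hv : ∀ (t : ℕ) (m : N), ∃ u, (rs ++ [y]).prod ^ u • m ∈
      (Ideal.ofList ((rs ++ [y]).map (· ^ (t + u))) • ⊤ : Submodule R N)) (n : N) :
    ∃ s : ℕ, y ^ s • n ∈ (Ideal.ofList rs • ⊤ : Submodule R N) := by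
  set E := TopCech N rs.get with hE
  set T := powTorsion y E with hT
  have hcof : IsCofinite T rs := isCofinite_powTorsion_topCech hm h hJ
  have hN := (killedBy_of_surjective rs T.mkQ T.mkQ_surjective (by
    rw [Submodule.ker_mkQ]; exact hcof)).1 (isNoetherian_killedBy_topCech hm h)
  -- The top cohomology of `rs, y` is the cokernel of `E → E_y`; its vanishing says `E = y E + T`.
  have hdiv : ∀ e : E, ∃ e', e - y • e' ∈ T := by
    intro e
    obtain ⟨t, m, rfl⟩ := cechClass_surjective _ e
    rw [← cechClass_add_pow rs.get t 1 m]
    generalize (∏ j, rs.get j) ^ 1 • m = m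
    obtain ⟨u, hu⟩ := hv (t + 1) m
    rw [List.map_append, Ideal.ofList_append, sup_comm, Submodule.sup_smul, List.map_singleton,
      Ideal.ofList_singleton, Submodule.ideal_span_singleton_smul, Submodule.mem_sup] at hu
    obtain ⟨_, ⟨k, _, rfl⟩, z, hz, hzu⟩ := hu
    refine ⟨y ^ t • cechClass N rs.get (t + 1 + u) k, u, ?_⟩
    rw [smul_sub, sub_eq_zero, ← map_smul, ← cechClass_add_pow rs.get (t + 1) u]
    have hz0 : cechClass N rs.get (t + 1 + u) z = 0 :=
      (listCechClass_eq_zero_iff _ _ _).2 ⟨0, by simpa using hz⟩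
    have h2 : (∏ j, rs.get j) ^ u • y ^ u • m = y ^ (t + 1 + u) • k + z := by
      rw [smul_smul, ← mul_pow, prod_univ_list_get]
      rw [List.prod_append, List.prod_singleton] at hzu
      exact hzu.symm
    rw [h2, map_add, hz0, add_zero, map_smul, smul_smul, smul_smul]
    congr 1
    ring
  -- On `E / T` the element `y` is both injective and surjective, so the finitely generated part
  -- killed by `rs` equals `y` times itself, and Nakayama applies.
  have hbot : killedBy (E ⧸ T) rs = ⊥ := by
    refine Submodule.eq_bot_of_le_smul_of_le_jacobson_bot (Ideal.span {y}) _
      ((isNoetherian_submodule.1 hN) _ le_rfl) ?_ ?_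
    · intro c hc
      obtain ⟨e, rfl⟩ := T.mkQ_surjective c
      obtain ⟨e', he'⟩ := hdiv e
      have h1 : T.mkQ e = y • T.mkQ e' := by
        rw [← map_smul, ← sub_eq_zero, ← map_sub]
        exact (Submodule.Quotient.mk_eq_zero T).2 he'
      rw [h1] at hc ⊢
      refine Submodule.smul_mem_smul (Ideal.mem_span_singleton_self y) fun r hr => ?_
      have h2 := hc r hr
      rw [smul_comm, ← map_smul, ← map_smul] at h2
      rw [← map_smul]
      exact (Submodule.Quotient.mk_eq_zero T).2
        (mem_powTorsion_of_smul_mem ((Submodule.Quotient.mk_eq_zero T).1 h2))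
    · rw [Ideal.span_singleton_le_iff_mem]
      exact maximalIdeal_le_jacobson _ hy
  have h1 : T.mkQ (cechClass N rs.get 1 n) ∈ killedBy (E ⧸ T) rs := fun r hr => by
    rw [← map_smul, cechClass_smul_of_mem_killed rs hr, map_zero]
  rw [hbot, Submodule.mem_bot] at h1
  obtain ⟨s, hs⟩ := (Submodule.Quotient.mk_eq_zero T).1 h1
  refine ⟨s, ?_⟩
  rw [← map_smul] at hs
  simpa using mem_of_cechClass_eq_zero hm h (t := 0) hs

end Nonvanishing

end TrivExtCM

namespace TrivExtCM

open RingTheory.Sequence IsLocalRing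

/-! ### Membership in `J N` after localization -/

section Localization

variable {R : Type*} [CommRing R] {N : Type*} [AddCommGroup N] [Module R N]
  (P : Ideal R) [P.IsPrime]

lemma mk_one_mem_map_smul_top {J : Ideal R} {n : N} (hn : n ∈ (J • ⊤ : Submodule R N)) :
    LocalizedModule.mkLinearMap P.primeCompl N n ∈
      (J.map (algebraMap R (Localization.AtPrime P)) • ⊤ :
        Submodule (Localization.AtPrime P) (LocalizedModule P.primeCompl N)) := by
  refine Submodule.smul_induction_on hn (fun r hr m _ => ?_) fun a b ha hb => ?_
  · rw [map_smul, ← algebraMap_smul (Localization.AtPrime P) r]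
    exact Submodule.smul_mem_smul (Ideal.mem_map_of_mem _ hr) trivial
  · rw [map_add]; exact add_mem ha hb

lemma exists_smul_eq_of_mem_map_smul_top {J : Ideal R} {z : LocalizedModule P.primeCompl N}
    (hz : z ∈ (J.map (algebraMap R (Localization.AtPrime P)) • ⊤ :
        Submodule (Localization.AtPrime P) (LocalizedModule P.primeCompl N))) :
    ∃ b ∉ P, ∃ n ∈ (J • ⊤ : Submodule R N),
      b • z = LocalizedModule.mkLinearMap P.primeCompl N n := by
  refine Submodule.smul_induction_on hz (fun a ha w _ => ?_) ?_
  · induction w using LocalizedModule.induction_on with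
    | h m s =>
      obtain ⟨⟨r, d⟩, hr⟩ :=
        (IsLocalization.mem_map_algebraMap_iff P.primeCompl (Localization.AtPrime P)).1 ha
      refine ⟨d * s, (d * s).2, (r : R) • m, Submodule.smul_mem_smul r.2 trivial, ?_⟩
      have h1 : (d : R) • a = algebraMap R (Localization.AtPrime P) r := by
        rw [← hr, Algebra.smul_def, mul_comm]
      have h2 : (s : R) • (LocalizedModule.mk m s : LocalizedModule P.primeCompl N) =
          LocalizedModule.mkLinearMap _ N m := by
        rw [LocalizedModule.mkLinearMap_apply, LocalizedModule.smul'_mk, LocalizedModule.mk_eq]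
        exact ⟨1, by simp [Submonoid.smul_def]⟩
      rw [mul_smul, smul_comm (s : R), h2, ← smul_assoc, h1, algebraMap_smul, map_smul]
  · rintro z w ⟨b, hb, n, hn, h1⟩ ⟨c, hc, k, hk, h2⟩
    refine ⟨b * c, fun h => (Ideal.IsPrime.mem_or_mem ‹_› h).elim hb hc, c • n + b • k,
      add_mem (Submodule.smul_mem _ _ hn) (Submodule.smul_mem _ _ hk), ?_⟩
    rw [map_add, map_smul, map_smul, ← h1, ← h2, smul_add, smul_smul, smul_smul, mul_comm c b]

lemma exists_smul_mem_of_mk_one_mem {J : Ideal R} {n : N}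
    (h : LocalizedModule.mkLinearMap P.primeCompl N n ∈
      (J.map (algebraMap R (Localization.AtPrime P)) • ⊤ :
        Submodule (Localization.AtPrime P) (LocalizedModule P.primeCompl N))) :
    ∃ b ∉ P, b • n ∈ (J • ⊤ : Submodule R N) := by
  obtain ⟨b, hb, k, hk, h⟩ := exists_smul_eq_of_mem_map_smul_top P h
  rw [← map_smul] at h
  obtain ⟨c, hc⟩ := (IsLocalizedModule.eq_iff_exists P.primeCompl _).1 h
  refine ⟨c * b, fun h => (Ideal.IsPrime.mem_or_mem ‹_› h).elim c.2 hb, ?_⟩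
  rw [mul_smul]
  exact hc ▸ Submodule.smul_mem _ _ hk

end Localization

/-! ### Cohen-Macaulay modules have regular sequences of maximal length -/

section Parameter

variable {R : Type*} [CommRing R]
  {N : Type*} [AddCommGroup N] [Module R N] [Module.Finite R N]

lemma mem_support_quotient_smul_top_iff {J : Ideal R} {p : PrimeSpectrum R} :
    p ∈ Module.support R (N ⧸ (J • ⊤ : Submodule R N)) ↔
      Module.annihilator R N ⊔ J ≤ p.asIdeal := by
  rw [Module.support_quotient, Set.mem_inter_iff, Module.mem_support_iff_of_finite, sup_le_iff]
  rfl

lemma ofList_smul_top_ne_top [IsLocalRing R] [Nontrivial N] {rs : List R}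
    (hm : ∀ a ∈ rs, a ∈ maximalIdeal R) : Ideal.ofList rs • (⊤ : Submodule R N) ≠ ⊤ :=
  (Submodule.top_ne_ideal_smul_of_le_jacobson_annihilator
    ((Ideal.span_le.mpr hm).trans (maximalIdeal_le_jacobson _))).symm

variable [IsNoetherianRing R]

/-- After localizing at `P` the sequence `rs, y` generates an ideal primary to the maximal ideal
modulo the annihilator. Vanishing would make `y` nilpotent on `N_P / rs N_P`, hence put `y` into a
minimal prime `q ≤ P` of the support of `N / rs N`. -/
theorem topNonzeroAt_append_singleton {rs : List R} (h : IsWeaklyRegular N rs) {y : R}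
    (hy : ∀ q ∈ (Module.annihilator R N ⊔ Ideal.ofList rs).minimalPrimes, y ∉ q) {P : Ideal R}
    (hP : P ∈ (Module.annihilator R N ⊔ Ideal.ofList (rs ++ [y])).minimalPrimes) :
    TopNonzeroAt N (rs ++ [y]) P := by
  have := hP.1.1
  by_contra hcon
  simp only [TopNonzeroAt, not_exists, not_forall, not_not] at hcon
  set A := Localization.AtPrime P
  set NP := LocalizedModule P.primeCompl N
  set f := LocalizedModule.mkLinearMap P.primeCompl N
  have hmem : ∀ a ∈ rs ++ [y], a ∈ P := fun a ha =>
    hP.1.2 (Ideal.mem_sup_right (Ideal.subset_span ha))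
  have hmax : ∀ a ∈ P, algebraMap R A a ∈ maximalIdeal A := fun a ha =>
    (IsLocalization.AtPrime.to_map_mem_maximal_iff A P a).2 ha
  have hlist : rs.map (algebraMap R A) ++ [algebraMap R A y] =
      (rs ++ [y]).map (algebraMap R A) := by
    simp
  have hpow : ∀ (ss : List R) (k : ℕ), Ideal.ofList ((ss.map (algebraMap R A)).map (· ^ k)) =
      (Ideal.ofList (ss.map (· ^ k))).map (algebraMap R A) := by
    intro ss k
    rw [Ideal.map_ofList, List.map_map, List.map_map]
    congr 2
    funext a
    simp
  obtain ⟨q, hq, hqP⟩ := Ideal.exists_minimalPrimes_le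
    (show Module.annihilator R N ⊔ Ideal.ofList rs ≤ P from
      (sup_le_sup_left (Ideal.span_mono fun a ha => List.mem_append_left _ ha) _).trans hP.1.2)
  have hqs : (⟨q, hq.1.1⟩ : PrimeSpectrum R) ∈
      Module.support R (N ⧸ (Ideal.ofList rs • ⊤ : Submodule R N)) :=
    mem_support_quotient_smul_top_iff.2 hq.1.2
  obtain ⟨m, hm⟩ := Module.mem_support_iff'.1 hqs
  obtain ⟨m, rfl⟩ := Submodule.mkQ_surjective _ m
  have hm' : ∀ r ∉ q, r • m ∉ (Ideal.ofList rs • ⊤ : Submodule R N) := fun r hr h =>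
    hm r hr ((Submodule.Quotient.mk_eq_zero _).2 h)
  obtain ⟨s, hs⟩ := exists_pow_smul_mem_of_vanishing (R := A) (N := NP)
    (rs := rs.map (algebraMap R A)) (y := algebraMap R A y)
    (by
      intro b hb
      obtain ⟨a, ha, rfl⟩ := List.mem_map.1 hb
      exact hmax a (hmem a (List.mem_append_left _ ha)))
    (hmax y (hmem y (by simp)))
    (h.of_isLocalizedModule A P.primeCompl f)
    (by
      intro Q hQ hle
      have hQ' : (Q.comap (algebraMap R A)).IsPrime := hQ.comap _
      have h1 : Module.annihilator R N ⊔ Ideal.ofList (rs ++ [y]) ≤ Q.comap (algebraMap R A) := by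
        refine sup_le (fun a ha => ?_) (Ideal.span_le.2 fun a ha => ?_)
        · refine hle (Ideal.mem_sup_left (Module.mem_annihilator.2 fun z => ?_))
          rw [algebraMap_smul]
          induction z using LocalizedModule.induction_on with
          | h n b => rw [LocalizedModule.smul'_mk, Module.mem_annihilator.1 ha,
              LocalizedModule.zero_mk]
        · refine hle (Ideal.mem_sup_right (Ideal.subset_span ?_))
          rw [hlist]
          exact List.mem_map.2 ⟨a, ha, rfl⟩
      have h2 : Q.comap (algebraMap R A) ≤ P := by
        intro a ha
        by_contra haP
        exact hQ.ne_top (Ideal.eq_top_of_isUnit_mem _ ha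
          (IsLocalization.map_units A (⟨a, haP⟩ : P.primeCompl)))
      have h3 := hP.2 ⟨hQ', h1⟩ h2
      refine le_antisymm (le_maximalIdeal hQ.ne_top) ?_
      rw [← Localization.AtPrime.map_eq_maximalIdeal]
      exact Ideal.map_le_iff_le_comap.2 h3)
    (by
      intro t z
      induction z using LocalizedModule.induction_on with
      | h n b =>
        obtain ⟨c, hc, u, hu⟩ := hcon t n
        refine ⟨u, ?_⟩
        rw [hlist, hpow, ← map_list_prod]
        have h1 := mk_one_mem_map_smul_top P hu
        have hcu : IsUnit (algebraMap R A c) := IsLocalization.map_units A (⟨c, hc⟩ : P.primeCompl)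
        have hbu : IsUnit (algebraMap R A b) := IsLocalization.map_units A b
        have h2 : algebraMap R A b • (LocalizedModule.mk n b : NP) = f n := by
          rw [algebraMap_smul, LocalizedModule.mkLinearMap_apply, LocalizedModule.smul'_mk,
            LocalizedModule.mk_eq]
          exact ⟨1, by simp [Submonoid.smul_def]⟩
        rw [← Submodule.smul_mem_iff_of_isUnit _ hbu, ← Submodule.smul_mem_iff_of_isUnit _ hcu,
          smul_comm (algebraMap R A b), h2, ← map_pow, algebraMap_smul, algebraMap_smul, ← map_smul,
          ← map_smul]
        exact h1)
    (f m)
  rw [← map_pow, algebraMap_smul, ← map_smul, ← Ideal.map_ofList] at hs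
  obtain ⟨b, hb, hbm⟩ := exists_smul_mem_of_mk_one_mem P hs
  rw [smul_smul] at hbm
  refine hm' _ (fun hbq => ?_) hbm
  rcases hq.1.1.mem_or_mem hbq with hbq | hyq
  · exact hb (hqP hbq)
  · exact hy q hq (hq.1.1.mem_of_pow_mem _ hyq)

variable [IsLocalRing R] [Nontrivial N]

theorem isParameterSeq_append_singleton {rs : List R} (h : IsWeaklyRegular N rs) {y : R}
    (hm : ∀ a ∈ rs ++ [y], a ∈ maximalIdeal R)
    (hy : ∀ q ∈ (Module.annihilator R N ⊔ Ideal.ofList rs).minimalPrimes, y ∉ q) :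
    IsParameterSeq R N (rs ++ [y]) := by
  rw [isParameterSeq_iff]
  refine ⟨ofList_smul_top_ne_top hm, fun p hp => ?_⟩
  obtain ⟨P, hP, hPp⟩ := Ideal.exists_minimalPrimes_le (mem_support_quotient_smul_top_iff.1 hp)
  exact (topNonzeroAt_append_singleton h hy hP).mono hPp

/-- A Cohen-Macaulay module over a Noetherian local ring has a regular sequence of every length
up to its dimension. -/
theorem IsCohenMacaulay.exists_isRegular (hN : IsCohenMacaulay R N) (k : ℕ)
    (hk : (k : WithBot ℕ∞) ≤ Module.supportDim R N) :
    ∃ rs : List R, rs.length = k ∧ IsRegular N rs := by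
  induction k with
  | zero => exact ⟨[], rfl, .nil R N⟩
  | succ k ih =>
    obtain ⟨rs, hrs, hreg⟩ := ih (le_trans (by exact_mod_cast Nat.le_succ k) hk)
    have hm := mem_maximalIdeal_of_ofList_smul_ne_top hreg.top_ne_smul.symm
    set I := Module.annihilator R N ⊔ Ideal.ofList rs with hI
    -- Otherwise the support of `N / rs N` is the closed point and `dim N ≤ k`. Prime avoidance then
    -- supplies `y`.
    have hnot : ∀ q ∈ I.minimalPrimes, ¬ maximalIdeal R ≤ q := by
      intro q hq hle
      have hdim := Module.supportDim_add_length_eq_supportDim_of_isRegular rs hreg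
      have hsub : Subsingleton (Module.support R (N ⧸ (Ideal.ofList rs • ⊤ : Submodule R N))) := by
        refine ⟨fun a b => ?_⟩
        have key : ∀ c : Module.support R (N ⧸ (Ideal.ofList rs • ⊤ : Submodule R N)),
            c.1.asIdeal = maximalIdeal R := by
          intro c
          have h1 := mem_support_quotient_smul_top_iff.1 c.2
          have h2 := hq.2 ⟨c.1.2, h1⟩ ((le_maximalIdeal c.1.2.ne_top).trans hle)
          exact le_antisymm (le_maximalIdeal c.1.2.ne_top) (hle.trans h2)
        exact Subtype.ext (PrimeSpectrum.ext ((key a).trans (key b).symm))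
      have h0 : Module.supportDim R (N ⧸ (Ideal.ofList rs • ⊤ : Submodule R N)) ≤ 0 :=
        Order.krullDim_nonpos_of_subsingleton
      have h1 : Module.supportDim R N ≤ (k : WithBot ℕ∞) := by
        rw [← hdim, hrs]
        calc _ ≤ 0 + (k : WithBot ℕ∞) := by gcongr
          _ = k := zero_add _
      have := hk.trans h1
      have : k + 1 ≤ k := by exact_mod_cast this
      omega
    obtain ⟨y, hym, hy⟩ : ∃ y ∈ maximalIdeal R, ∀ q ∈ I.minimalPrimes, y ∉ q := by
      by_contra! hcon
      have hfin := I.finite_minimalPrimes_of_isNoetherianRing R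
      have := (Ideal.subset_union_prime (s := hfin.toFinset) (f := id) (I := maximalIdeal R) ⊥ ⊥
        (fun i hi _ _ => ((Set.Finite.mem_toFinset hfin).1 hi).1.1)).1 (fun y hy => by
          obtain ⟨q, hq, hyq⟩ := hcon y hy
          simp only [Set.mem_iUnion]
          exact ⟨q, by simpa using hq, hyq⟩)
      obtain ⟨q, hq, hle⟩ := this
      exact hnot q ((Set.Finite.mem_toFinset hfin).1 hq) hle
    refine ⟨rs ++ [y], by simp [hrs], ?_⟩
    refine (hN (rs ++ [y]) fun i _ hi => ?_).resolve_left (by simp)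
    rcases Nat.lt_or_ge rs.length i with hlt | hle
    · rw [List.take_of_length_le (by simp; omega)]
      refine isParameterSeq_append_singleton hreg.toIsWeaklyRegular (fun a ha => ?_)
        hy
      rcases List.mem_append.1 ha with ha | ha
      · exact hm a ha
      · rwa [List.mem_singleton.1 ha]
    · rw [List.take_append_of_le_length hle]
      exact isParameterSeq_of_isRegular (isRegular_take hreg i)

end Parameter

end TrivExtCM

namespace TrivExtCM

open RingTheory.Sequence IsLocalRing CategoryTheory Abelian

/-! ### Depth of quotients and dimension of associated primes -/

section Depth

universe u v

variable {R : Type u} [CommRing R] [IsLocalRing R]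

lemma maximalIdeal_smul_top_lt_top (N : Type*) [AddCommGroup N] [Module R N] [Module.Finite R N]
    [Nontrivial N] : maximalIdeal R • (⊤ : Submodule R N) < ⊤ :=
  lt_top_iff_ne_top.2 (Submodule.top_ne_ideal_smul_of_le_jacobson_annihilator
    (maximalIdeal_le_jacobson _)).symm

variable [IsNoetherianRing R]

/-- Rees's criterion detects depth by vanishing of Ext; the long exact sequence of multiplication by
`x` costs one degree. -/
lemma exists_isRegular_quotSMulTop_of_small {N : Type v} [Small.{v} R] [AddCommGroup N] [Module R N]
    [Module.Finite R N] {x : R} (hx : IsSMulRegular N x) (hxm : x ∈ maximalIdeal R) {rs : List R}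
    (hrs : IsRegular N rs) {k : ℕ} (hk : rs.length = k + 1) :
    ∃ ss : List R, ss.length = k ∧ IsRegular (QuotSMulTop x N) ss := by
  have hN := hrs.nontrivial
  have hm := mem_maximalIdeal_of_ofList_smul_ne_top hrs.top_ne_smul.symm
  have hNx : Nontrivial (QuotSMulTop x N) := by
    have := ((isRegular_iff_isWeaklyRegular_of_subset_maximalIdeal (M := N) (rs := [x])
      (by simpa using hxm)).2 ((isWeaklyRegular_singleton_iff _ _).2 hx))
    exact ((isRegular_cons_iff _ _ _).1 this).2.nontrivial
  have h := (ModuleCat.exists_isRegular_tfae (maximalIdeal R) (k + 1) (ModuleCat.of R N)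
    (maximalIdeal_smul_top_lt_top N)).out 1 3
  have h' := (ModuleCat.exists_isRegular_tfae (maximalIdeal R) k
    (ModuleCat.of R (QuotSMulTop x N)) (maximalIdeal_smul_top_lt_top _)).out 1 3
  have hext := h.2 ⟨rs, hk, hm, hrs⟩
  obtain ⟨ss, hss, -, hreg⟩ := h'.1 fun i hi => by
    have zero1 := AddCommGrpCat.isZero_of_iff_subsingleton.mpr (hext i (by omega))
    have zero2 := AddCommGrpCat.isZero_of_iff_subsingleton.mpr (hext (i + 1) (by omega))
    exact AddCommGrpCat.subsingleton_of_isZero <| ShortComplex.Exact.isZero_of_both_zeros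
      ((Ext.covariant_sequence_exact₃' _ (IsSMulRegular.smulShortComplex_shortExact
        (M := ModuleCat.of R N) hx)) i (i + 1) rfl)
      (zero1.eq_zero_of_src _) (zero2.eq_zero_of_tgt _)
  exact ⟨ss, hss, hreg⟩

variable {N : Type v} [AddCommGroup N] [Module R N]

/-- Dividing by a regular element lowers the depth by at most one. -/
theorem exists_isRegular_quotSMulTop [Module.Finite R N] {x : R}
    (hx : IsSMulRegular N x) (hxm : x ∈ maximalIdeal R) {rs : List R}
    (hrs : IsRegular N rs) {k : ℕ} (hk : rs.length = k + 1) :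
    ∃ ss : List R, ss.length = k ∧ IsRegular (QuotSMulTop x N) ss := by
  -- The lift places `N` in a universe where `R` is small, as the Ext groups require.
  let e : ULift.{u} N ≃ₗ[R] N := ULift.moduleEquiv
  have := Module.Finite.equiv e.symm
  obtain ⟨ss, hss, hreg⟩ := exists_isRegular_quotSMulTop_of_small (N := ULift.{u} N)
    ((e.isSMulRegular_congr x).2 hx) hxm ((e.isRegular_congr rs).2 hrs) hk
  exact ⟨ss, hss, ((QuotSMulTop.congr x e).isRegular_congr ss).1 hreg⟩

theorem exists_isRegular_quotient [Module.Finite R N] {rs ss : List R}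
    (hrs : IsRegular N rs) (hss : IsRegular N ss) {k : ℕ} (hk : ss.length = rs.length + k) :
    ∃ ts : List R, ts.length = k ∧
      IsRegular (N ⧸ (Ideal.ofList rs • ⊤ : Submodule R N)) ts := by
  induction rs generalizing N ss with
  | nil =>
    refine ⟨ss, by simpa using hk, ?_⟩
    let e : (N ⧸ (Ideal.ofList ([] : List R) • ⊤ : Submodule R N)) ≃ₗ[R] N :=
      Submodule.quotEquivOfEqBot _ (by rw [Ideal.ofList_nil, Submodule.bot_smul])
    exact (e.isRegular_congr ss).2 hss
  | cons r rs ih =>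
    have hm := mem_maximalIdeal_of_ofList_smul_ne_top hrs.top_ne_smul.symm
    rw [isRegular_cons_iff] at hrs
    obtain ⟨ts, hts, hreg⟩ := exists_isRegular_quotSMulTop hrs.1 (hm r (by simp)) hss
      (k := rs.length + k) (by rw [hk, List.length_cons]; ring)
    obtain ⟨us, hus, hreg⟩ := ih hrs.2 hreg hts
    exact ⟨us, hus, ((Submodule.quotOfListConsSMulTopEquivQuotSMulTopInner N r rs).isRegular_congr
      us).2 hreg⟩

/-- An element of `q` outside `p` is regular on the domain `R / p`, so dividing by it lowers the
dimension by exactly one. -/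
lemma supportDim_quotient_add_one_le {p q : Ideal R} [p.IsPrime] [q.IsPrime] (h : p < q) :
    Module.supportDim R (R ⧸ q) + 1 ≤ Module.supportDim R (R ⧸ p) := by
  obtain ⟨z, hzq, hzp⟩ := SetLike.exists_of_lt h
  have hz : IsSMulRegular (R ⧸ p) z := by
    rw [isSMulRegular_iff_right_eq_zero_of_smul]
    intro a ha
    rw [Algebra.smul_def] at ha
    exact (mul_eq_zero.1 ha).resolve_left (by
      rwa [Ideal.Quotient.algebraMap_eq, Ideal.Quotient.eq_zero_iff_mem])
  rw [← Module.supportDim_quotSMulTop_succ_eq_supportDim hz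
    (le_maximalIdeal (Ideal.IsPrime.ne_top ‹_›) hzq)]
  gcongr
  refine Module.supportDim_le_of_surjective
    (Submodule.liftQ _ (Submodule.factor h.le) ?_) ?_
  · rintro _ ⟨a, _, rfl⟩
    obtain ⟨a, rfl⟩ := Submodule.mkQ_surjective _ a
    change (Submodule.Quotient.mk (z • a) : R ⧸ q) = 0
    rw [Submodule.Quotient.mk_eq_zero]
    exact Ideal.mul_mem_right _ _ hzq
  · intro a
    obtain ⟨a, rfl⟩ := Submodule.mkQ_surjective _ a
    exact ⟨Submodule.Quotient.mk (Submodule.Quotient.mk a), rfl⟩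

lemma exists_isAssociatedPrime_quotSMulTop [Module.Finite R N] {p : Ideal R}
    (hp : IsAssociatedPrime p N) {z : R} (hz : IsSMulRegular N z) (hzm : z ∈ maximalIdeal R) :
    ∃ q, IsAssociatedPrime q (QuotSMulTop z N) ∧ p < q := by
  obtain ⟨hp1, x, hx⟩ := isAssociatedPrime_iff.1 hp
  set K := Submodule.torsionBySet R N p
  have hmemK : ∀ n, n ∈ K ↔ ∀ a ∈ p, a • n = 0 := fun n => by
    simp [K, Submodule.mem_torsionBySet_iff]
  have hxp : ∀ a, a ∈ p ↔ a • x = 0 := fun a => by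
    rw [hx, Submodule.mem_colon_singleton, Submodule.mem_bot]
  have hzp : z ∉ p := by
    intro h
    refine hp1.ne_top ((Ideal.eq_top_iff_one _).2 ((hxp 1).2 ?_))
    rw [one_smul]
    exact isSMulRegular_iff_right_eq_zero_of_smul.1 hz _ ((hxp z).1 h)
  -- If the elements killed by `p` all lay in `z N`, regularity of `z` would give `K = z K`, and
  -- Nakayama `K = 0`. An `n` outside `z N` has a nonzero class killed by `p` and by `z ∉ p`.
  obtain ⟨n, hnK, hn⟩ : ∃ n ∈ K, ∀ k, z • k ≠ n := by
    by_contra! hcon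
    have hle : K ≤ Ideal.span {z} • K := by
      intro n hn
      obtain ⟨k, rfl⟩ := hcon n hn
      refine Submodule.smul_mem_smul (Ideal.mem_span_singleton_self z) ((hmemK k).2 fun a ha => ?_)
      refine isSMulRegular_iff_right_eq_zero_of_smul.1 hz _ ?_
      rw [smul_comm]
      exact (hmemK _).1 hn a ha
    have hK : K = ⊥ := Submodule.eq_bot_of_le_smul_of_le_jacobson_bot _ K
      (IsNoetherian.noetherian K) hle (by
        rw [IsLocalRing.jacobson_eq_maximalIdeal _ bot_ne_top]
        simpa using hzm)
    have hx0 : x = 0 := by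
      rw [← Submodule.mem_bot R, ← hK]
      exact (hmemK x).2 fun a ha => (hxp a).1 ha
    exact hp1.ne_top ((Ideal.eq_top_iff_one _).2 ((hxp 1).2 (by rw [hx0, smul_zero])))
  obtain ⟨q, hq, hle⟩ := exists_le_isAssociatedPrime_of_isNoetherianRing R
    (Submodule.Quotient.mk n : QuotSMulTop z N) (by
      rw [Ne, mk_quotSMulTop_eq_zero_iff]
      exact fun ⟨k, hk⟩ => hn k hk)
  have hmem : ∀ a : R, (Submodule.Quotient.mk (a • n) : QuotSMulTop z N) = 0 → a ∈ q := fun a ha =>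
    hle (by rw [Submodule.mem_colon_singleton, Submodule.mem_bot]; exact ha)
  refine ⟨q, hq, lt_of_le_of_ne (fun a ha => hmem a ?_) ?_⟩
  · rw [(hmemK n).1 hnK a ha]; rfl
  · rintro rfl
    exact hzp (hmem z ((mk_quotSMulTop_eq_zero_iff _ _).2 ⟨n, rfl⟩))

/-- The length of a regular sequence on `N` is at most the dimension of `R ⧸ p` for every
associated prime `p` of `N`. -/
theorem length_le_supportDim_of_isAssociatedPrime [Module.Finite R N] {rs : List R}
    (hrs : IsRegular N rs) {p : Ideal R} (hp : IsAssociatedPrime p N) :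
    (rs.length : WithBot ℕ∞) ≤ Module.supportDim R (R ⧸ p) := by
  induction rs generalizing N p with
  | nil =>
    have := Ideal.Quotient.nontrivial_iff.2 hp.1.ne_top
    have := Module.supportDim_ne_bot_of_nontrivial R (R ⧸ p)
    rw [List.length_nil, Nat.cast_zero]
    generalize Module.supportDim R (R ⧸ p) = d at this
    cases d with
    | bot => exact absurd rfl this
    | coe d => exact_mod_cast bot_le
  | cons r rs ih =>
    have hm := mem_maximalIdeal_of_ofList_smul_ne_top hrs.top_ne_smul.symm
    rw [isRegular_cons_iff] at hrs
    obtain ⟨q, hq, hlt⟩ := exists_isAssociatedPrime_quotSMulTop hp hrs.1 (hm r (by simp))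
    have := hp.1
    have := hq.1
    refine le_trans ?_ (supportDim_quotient_add_one_le hlt)
    rw [List.length_cons, Nat.cast_add, Nat.cast_one]
    gcongr
    exact ih hrs.2 hq

end Depth

/-! ### Depth equal to dimension implies Cohen-Macaulay -/

section Converse

variable {R : Type*} [CommRing R]

lemma exists_mul_pow_mem_of_mem_minimalPrimes {I p : Ideal R} (hp : p ∈ I.minimalPrimes) {y : R}
    (hy : y ∈ p) : ∃ s ∉ p, ∃ c : ℕ, s * y ^ c ∈ I := by
  have := hp.1.1
  have h : algebraMap R (Localization.AtPrime p) y ∈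
      (I.map (algebraMap R (Localization.AtPrime p))).radical := by
    rw [IsLocalization.AtPrime.radical_map_of_mem_minimalPrimes _ p I hp]
    exact Ideal.mem_map_of_mem _ hy
  obtain ⟨c, hc⟩ := h
  rw [← map_pow, IsLocalization.algebraMap_mem_map_algebraMap_iff p.primeCompl] at hc
  obtain ⟨s, hs, h⟩ := hc
  exact ⟨s, hs, c, h⟩

variable {N : Type*} [AddCommGroup N] [Module R N]

lemma exists_ofList_pow_le (rs : List R) (t : ℕ) :
    ∃ k, Ideal.ofList rs ^ k ≤ Ideal.ofList (rs.map (· ^ t)) :=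
  Ideal.exists_pow_le_of_le_radical_of_fg
    (Ideal.span_le.2 fun a ha => ⟨t, Ideal.subset_span (List.mem_map.2 ⟨a, ha, rfl⟩)⟩)
    (Submodule.fg_span (List.finite_toSet rs))

/-- Some `s * y ^ c` with `s ∉ p` kills `N / rs N`, so its `k`-th power sends `N` into `(rs ^ t) N`
for large `k`. Multiplying by `rs.prod ^ (c * k)` kills the class with `u = c * k`. -/
lemma not_topNonzeroAt_append_singleton {rs : List R} {p : Ideal R}
    (hp : p ∈ (Module.annihilator R (N ⧸ (Ideal.ofList rs • ⊤ : Submodule R N))).minimalPrimes)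
    {y : R} (hy : y ∈ p) : ¬ TopNonzeroAt N (rs ++ [y]) p := by
  rintro ⟨t, m, h⟩
  obtain ⟨s, hs, c, hsc⟩ := exists_mul_pow_mem_of_mem_minimalPrimes hp hy
  obtain ⟨k, hk⟩ := exists_ofList_pow_le rs t
  have h1 : ∀ (j : ℕ) (n : N), (s * y ^ c) ^ j • n ∈ (Ideal.ofList rs ^ j • ⊤ : Submodule R N) := by
    intro j
    induction j with
    | zero => simp
    | succ j ih =>
      intro n
      have h2 : (s * y ^ c) • n ∈ (Ideal.ofList rs • ⊤ : Submodule R N) :=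
        (Submodule.Quotient.mk_eq_zero _).1 (Module.mem_annihilator.1 hsc (Submodule.Quotient.mk n))
      have h3 : ∀ w ∈ (Ideal.ofList rs • ⊤ : Submodule R N),
          (s * y ^ c) ^ j • w ∈ (Ideal.ofList rs ^ (j + 1) • ⊤ : Submodule R N) := by
        intro w hw
        refine Submodule.smul_induction_on hw (fun r hr n _ => ?_) fun a b ha hb => ?_
        · rw [smul_comm, pow_succ' (Ideal.ofList rs), Submodule.mul_smul]
          exact Submodule.smul_mem_smul hr (ih n)
        · rw [smul_add]; exact add_mem ha hb
      rw [pow_succ (s * y ^ c), mul_smul]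
      exact h3 _ h2
  have h2 := list_prod_pow_smul_mem rs (c * k) (Submodule.smul_mono_left hk (h1 k m))
  refine h (s ^ k) (fun h => hs (hp.1.1.mem_of_pow_mem _ h)) (c * k) ?_
  refine Submodule.smul_mono_left (Ideal.span_mono ?_) ((congrArg (· ∈ _) ?_).mp h2)
  · intro a ha
    exact List.mem_map.2 (by
      obtain ⟨b, hb, rfl⟩ := List.mem_map.1 ha
      exact ⟨b, List.mem_append_left _ hb, rfl⟩)
  · rw [List.prod_append, List.prod_singleton]
    module

variable [IsLocalRing R] [IsNoetherianRing R] [Module.Finite R N]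

/-- A module whose depth equals its dimension is Cohen-Macaulay. -/
theorem isCohenMacaulay_of_isRegular {ss : List R} (hss : IsRegular N ss)
    (hdim : Module.supportDim R N = ss.length) : IsCohenMacaulay R N := by
  intro rs hrs
  have key : ∀ i ≤ rs.length, IsRegular N (rs.take i) := by
    intro i
    induction i with
    | zero =>
      have := hss.nontrivial
      exact fun _ => .nil R N
    | succ i ih =>
      intro hi
      have hreg := ih (by omega)
      have hpar := (isParameterSeq_iff _).1 (hrs (i + 1) (by omega) hi)
      refine ⟨?_, hpar.1.symm⟩
      rw [List.take_add_one, List.getElem?_eq_getElem (by omega), Option.toList_some] at hpar ⊢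
      set as := rs.take i
      set y := rs[i]
      rw [isWeaklyRegular_append_iff, isWeaklyRegular_singleton_iff]
      refine ⟨hreg.toIsWeaklyRegular, ?_⟩
      set N' := N ⧸ (Ideal.ofList as • ⊤ : Submodule R N)
      by_contra hy
      have hy' : y ∈ (⋃ p ∈ associatedPrimes R N', (p : Set R)) := by
        rw [biUnion_associatedPrimes_eq_compl_regular]; exact hy
      simp only [Set.mem_iUnion] at hy'
      obtain ⟨p, hp, hyp⟩ := hy'
      have hpprime := hp.1
      have hd := Module.supportDim_add_length_eq_supportDim_of_isRegular as hreg
      have hann : Module.annihilator R N' ≤ p := by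
        have := hp.annihilator_le
        rwa [Submodule.annihilator_top] at this
      have hsub : Module.annihilator R N ⊔ Ideal.ofList (as ++ [y]) ≤ p := by
        rw [Ideal.ofList_append, ← sup_assoc]
        refine sup_le (le_trans ?_ hann) (by simpa [Ideal.ofList_singleton] using hyp)
        refine sup_le ?_ fun a ha => Module.mem_annihilator.2 fun n => ?_
        · exact LinearMap.annihilator_le_of_surjective _ (Submodule.mkQ_surjective _)
        · obtain ⟨n, rfl⟩ := Submodule.mkQ_surjective _ n
          rw [← map_smul, Submodule.mkQ_apply, Submodule.Quotient.mk_eq_zero]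
          exact Submodule.smul_mem_smul ha trivial
      have hlen : as.length ≤ ss.length := by
        have : Nontrivial N' := hreg.quot_ofList_smul_nontrivial ⊤
        have h0 := Module.supportDim_ne_bot_of_nontrivial R N'
        change Module.supportDim R N' + _ = _ at hd
        rw [hdim] at hd
        generalize Module.supportDim R N' = d at *
        cases d with
        | bot => exact absurd rfl h0
        | coe d =>
          have : (as.length : WithBot ℕ∞) ≤ ss.length := by
            rw [← hd]
            exact_mod_cast le_add_self
          exact_mod_cast this
      obtain ⟨e, he⟩ := Nat.exists_eq_add_of_le hlen
      obtain ⟨ts, hts, htreg⟩ := exists_isRegular_quotient hreg hss he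
      have hN' : Module.supportDim R N' ≤ e := by
        change Module.supportDim R N' + _ = _ at hd
        rw [hdim, he] at hd
        generalize Module.supportDim R N' = d at *
        cases d with
        | bot => exact bot_le
        | coe d =>
          have hd : d + as.length = as.length + e := by exact_mod_cast hd
          cases d with
          | top => simp at hd; exact absurd hd (by exact_mod_cast ENat.top_ne_natCast _)
          | coe d =>
            have : d + as.length = as.length + e := by exact_mod_cast hd
            exact_mod_cast (by omega : d ≤ e)
      -- Unmixedness: `N'` has a regular sequence of length `e` and dimension at most `e`, while a
      -- smaller prime over the annihilator would give dimension at least `e + 1`.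
      have hmin : p ∈ (Module.annihilator R N').minimalPrimes := by
        refine ⟨⟨hpprime, hann⟩, fun q hq hqp => ?_⟩
        by_contra hnot
        have := hq.1
        have h1 := supportDim_quotient_add_one_le (lt_of_le_not_ge hqp hnot)
        have h2 := length_le_supportDim_of_isAssociatedPrime htreg hp
        have h3 : Module.supportDim R (R ⧸ q) ≤ Module.supportDim R N' := by
          rw [Module.supportDim_quotient_eq_ringKrullDim,
            Module.supportDim_eq_ringKrullDim_quotient_annihilator]
          exact ringKrullDim_le_of_surjective (Ideal.Quotient.factor hq.2)
            (Ideal.Quotient.factor_surjective _)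
        have h4 : (e : WithBot ℕ∞) + 1 ≤ e := by
          refine le_trans ?_ (h1.trans (h3.trans hN'))
          rw [hts] at h2
          gcongr
        have : e + 1 ≤ e := by exact_mod_cast h4
        omega
      exact not_topNonzeroAt_append_singleton hmin hyp
        (hpar.2 ⟨p, hpprime⟩ (mem_support_quotient_smul_top_iff.2 hsub))
  right
  simpa using key rs.length le_rfl

end Converse

end TrivExtCM

namespace TrivExtCM

open RingTheory.Sequence IsLocalRing

/-! ### Maximal Cohen-Macaulay modules and regular sequences of the ring -/

section MaximalCohenMacaulay

variable {R : Type*} [CommRing R] [IsLocalRing R] [IsNoetherianRing R]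
  {M : Type*} [AddCommGroup M] [Module R M] [Module.Finite R M]

lemma exists_ringKrullDim_eq_natCast (R : Type*) [CommRing R] [IsLocalRing R] [IsNoetherianRing R] :
    ∃ d : ℕ, ringKrullDim R = d := by
  have h1 : ringKrullDim R ≠ ⊥ := ringKrullDim_ne_bot
  have h2 : ringKrullDim R ≠ ⊤ := ringKrullDim_ne_top
  generalize ringKrullDim R = d at *
  cases d with
  | bot => exact absurd rfl h1
  | coe d =>
    cases d with
    | top => exact absurd rfl h2
    | coe d => exact ⟨d, rfl⟩

theorem isMaximalCohenMacaulay_of_isRegular (hR : IsCohenMacaulay R R)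
    (h : ∀ rs : List R, IsRegular R rs → IsRegular M rs) : IsMaximalCohenMacaulay R M := by
  obtain ⟨d, hd⟩ := exists_ringKrullDim_eq_natCast R
  obtain ⟨rs, hrs, hreg⟩ := hR.exists_isRegular d
    (by rw [Module.supportDim_self_eq_ringKrullDim, hd])
  have hM := h rs hreg
  have hle := Module.supportDim_le_ringKrullDim R M
  have hge : (d : WithBot ℕ∞) ≤ Module.supportDim R M := by
    rw [← Module.supportDim_add_length_eq_supportDim_of_isRegular rs hM, hrs]
    have := hM.quot_ofList_smul_nontrivial ⊤
    have := Module.supportDim_ne_bot_of_nontrivial R (M ⧸ (Ideal.ofList rs • ⊤ : Submodule R M))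
    generalize Module.supportDim R (M ⧸ (Ideal.ofList rs • ⊤ : Submodule R M)) = e at *
    cases e with
    | bot => exact absurd rfl this
    | coe e => exact_mod_cast le_add_self
  have heq : Module.supportDim R M = d := le_antisymm (hle.trans hd.le) hge
  exact ⟨isCohenMacaulay_of_isRegular hM (by rw [heq, hrs]), by rw [heq, hd]⟩

theorem isRegular_of_isMaximalCohenMacaulay [Nontrivial M] (hM : IsMaximalCohenMacaulay R M)
    {rs : List R} (hrs : IsRegular R rs) : IsRegular M rs := by
  obtain ⟨d, hd⟩ := exists_ringKrullDim_eq_natCast R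
  obtain ⟨ss, hss, hsreg⟩ := hM.1.exists_isRegular d (by rw [hM.2, hd])
  have hm := mem_maximalIdeal_of_ofList_smul_ne_top hrs.top_ne_smul.symm
  have key : ∀ i ≤ rs.length, IsWeaklyRegular M (rs.take i) := by
    intro i
    induction i with
    | zero => exact fun _ => .nil R M
    | succ i ih =>
      intro hi
      have hreg : IsRegular M (rs.take i) :=
        (isRegular_iff_isWeaklyRegular_of_subset_maximalIdeal
          fun r hr => hm r (List.mem_of_mem_take hr)).2 (ih (by omega))
      have hdim := ringKrullDim_add_length_eq_ringKrullDim_of_isRegular _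
        (isRegular_take hrs (i + 1))
      rw [List.length_take, min_eq_left hi, hd] at hdim
      have hlen : (rs.take i).length = i := by simp; omega
      rw [List.take_add_one, List.getElem?_eq_getElem (by omega), Option.toList_some] at hdim ⊢
      set as := rs.take i
      set y := rs[i]
      rw [isWeaklyRegular_append_iff, isWeaklyRegular_singleton_iff]
      refine ⟨hreg.toIsWeaklyRegular, ?_⟩
      by_contra hy
      have hy' : y ∈ (⋃ p ∈ associatedPrimes R (M ⧸ (Ideal.ofList as • ⊤ : Submodule R M)),
          (p : Set R)) := by
        rw [biUnion_associatedPrimes_eq_compl_regular]; exact hy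
      simp only [Set.mem_iUnion] at hy'
      obtain ⟨p, hp, hyp⟩ := hy'
      have hsub : Ideal.ofList (as ++ [y]) ≤ p := by
        rw [Ideal.ofList_append]
        refine sup_le (le_trans (fun a ha => ?_) hp.annihilator_le)
          (by simpa [Ideal.ofList_singleton] using hyp)
        rw [Submodule.annihilator_top]
        refine Module.mem_annihilator.2 fun n => ?_
        obtain ⟨n, rfl⟩ := Submodule.mkQ_surjective _ n
        rw [← map_smul, Submodule.mkQ_apply, Submodule.Quotient.mk_eq_zero]
        exact Submodule.smul_mem_smul ha trivial
      have hle : ringKrullDim (R ⧸ p) ≤ ringKrullDim (R ⧸ Ideal.ofList (as ++ [y])) :=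
        ringKrullDim_le_of_surjective (Ideal.Quotient.factor hsub)
          (Ideal.Quotient.factor_surjective _)
      rw [← Module.supportDim_quotient_eq_ringKrullDim] at hle
      have hne : ringKrullDim (R ⧸ Ideal.ofList (as ++ [y])) ≠ ⊥ := by
        intro h
        rw [h, WithBot.bot_add] at hdim
        exact absurd hdim (WithBot.bot_ne_coe (a := (d : ℕ∞)))
      generalize ringKrullDim (R ⧸ Ideal.ofList (as ++ [y])) = e at *
      obtain ⟨e, rfl⟩ : ∃ k : ℕ, e = k := by
        cases e with
        | bot => exact absurd rfl hne
        | coe e =>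
          cases e with
          | top =>
            have hdim : (⊤ : ℕ∞) + (i + 1 : ℕ) = d := by exact_mod_cast hdim
            rw [top_add] at hdim
            exact absurd hdim (ENat.top_ne_natCast _)
          | coe e => exact ⟨e, rfl⟩
      have hdim : e + (i + 1) = d := by exact_mod_cast hdim
      -- The quotient of `M` by `as` has depth at least `d - i = e + 1`, so `dim R / p ≥ e + 1`; yet
      -- `p` contains `as, y`, and `R / (as, y)` has dimension `e`.
      obtain ⟨ts, hts, htreg⟩ := exists_isRegular_quotient hreg hsreg (k := e + 1) (by omega)
      have h2 := (length_le_supportDim_of_isAssociatedPrime htreg hp).trans hle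
      have : e + 1 ≤ e := by rw [hts] at h2; exact_mod_cast h2
      omega
  exact (isRegular_iff_isWeaklyRegular_of_subset_maximalIdeal hm).2
    (by simpa using key rs.length le_rfl)

end MaximalCohenMacaulay

/-! ### Parameter sequences on the trivial extension -/

section TrivialExtension

open TrivSqZeroExt

variable {R : Type*} [CommRing R] {M : Type*} [AddCommGroup M] [Module R M] [Module Rᵐᵒᵖ M]
  [IsCentralScalar R M]

lemma isNoetherianRing_trivSqZeroExt [IsNoetherianRing R] [Module.Finite R M] :
    IsNoetherianRing (TrivSqZeroExt R M) :=
  have : Module.Finite R (TrivSqZeroExt R M) := inferInstanceAs (Module.Finite R (R × M))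
  IsNoetherianRing.of_finite R (TrivSqZeroExt R M)

/-- The projection of the trivial extension onto the base ring. -/
abbrev fstRingHom (R : Type*) [CommRing R] (M : Type*) [AddCommGroup M] [Module R M]
    [Module Rᵐᵒᵖ M] [IsCentralScalar R M] : TrivSqZeroExt R M →+* R :=
  (fstHom R R M).toRingHom

lemma fstRingHom_surjective : Function.Surjective (fstRingHom R M) := fun r => ⟨inl r, rfl⟩

lemma eq_inr_of_fstRingHom_eq_zero {w : TrivSqZeroExt R M} (h : fstRingHom R M w = 0) :
    w = inr w.snd := by
  ext
  · exact h
  · simp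

lemma mem_of_fst_eq_zero (P : Ideal (TrivSqZeroExt R M)) [hP : P.IsPrime]
    {w : TrivSqZeroExt R M} (h : w.fst = 0) : w ∈ P := by
  refine hP.mem_of_pow_mem 2 ?_
  have : w ^ 2 = 0 := by
    rw [eq_inr_of_fstRingHom_eq_zero (w := w) h, pow_two, inr_mul_inr]
  rw [this]
  exact P.zero_mem

lemma map_fst_ofList_pow (ys : List (TrivSqZeroExt R M)) (k : ℕ) :
    (Ideal.ofList (ys.map (· ^ k))).map (fstRingHom R M) =
      Ideal.ofList ((ys.map (fstRingHom R M)).map (· ^ k)) := by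
  rw [Ideal.map_ofList, List.map_map, List.map_map]
  congr 2

lemma exists_fst_eq_of_mem {ys : List (TrivSqZeroExt R M)} {k : ℕ} {r : R}
    (h : r ∈ Ideal.ofList ((ys.map (fstRingHom R M)).map (· ^ k))) :
    ∃ w ∈ Ideal.ofList (ys.map (· ^ k)), fstRingHom R M w = r := by
  rw [← map_fst_ofList_pow] at h
  exact (Ideal.mem_map_iff_of_surjective (fstRingHom R M) fstRingHom_surjective).1 h

variable [IsNoetherianRing R] [Module.Finite R M]

/-- The projection retracts the inclusion of `R`, so a vanishing relation in the extension projects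
to one in `R`. Primes of the extension contain the square-zero ideal, so membership depends only on
the first coordinate. -/
lemma isParameterSeq_map_inl {rs : List R} (h : IsParameterSeq R R rs) :
    IsParameterSeq (TrivSqZeroExt R M) (TrivSqZeroExt R M) (rs.map inl) := by
  have := isNoetherianRing_trivSqZeroExt (R := R) (M := M)
  have hmap : (rs.map (inl : R → TrivSqZeroExt R M)).map (fstRingHom R M) = rs := by
    rw [List.map_map]
    exact List.map_id _
  rw [isParameterSeq_iff] at h ⊢
  refine ⟨fun h' => h.1 ?_, fun P hP => ?_⟩
  · rw [smul_eq_mul, Ideal.mul_top] at h' ⊢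
    have := congrArg (Ideal.map (fstRingHom R M)) h'
    rwa [Ideal.map_ofList, hmap, Ideal.map_top] at this
  · have hle := le_sup_right.trans (mem_support_quotient_smul_top_iff.1 hP)
    obtain ⟨t, m, htm⟩ := h.2 (PrimeSpectrum.comap (inlHom R M) P)
      (mem_support_quotient_smul_top_iff.2 (sup_le (fun a ha => by
        have : a = 0 := by simpa using Module.mem_annihilator.1 ha 1
        rw [this]; exact zero_mem _) (Ideal.span_le.2 fun a ha =>
          hle (Ideal.subset_span (List.mem_map.2 ⟨a, ha, rfl⟩)))))
    refine ⟨t, inl m, fun s hs u hu => htm s.fst (fun hs' => hs ?_) u ?_⟩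
    · have h1 : inl s.fst ∈ P.asIdeal := hs'
      have h2 : s - inl s.fst ∈ P.asIdeal := mem_of_fst_eq_zero _ (by simp)
      simpa using add_mem h2 h1
    · rw [smul_eq_mul, Ideal.mul_top] at hu ⊢
      have := Ideal.mem_map_of_mem (fstRingHom R M) hu
      rw [map_fst_ofList_pow, hmap, smul_eq_mul, smul_eq_mul, map_mul, map_mul, map_pow,
        map_list_prod, hmap] at this
      exact this

lemma isParameterSeq_map_fst {ys : List (TrivSqZeroExt R M)}
    (h : IsParameterSeq (TrivSqZeroExt R M) (TrivSqZeroExt R M) ys) :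
    IsParameterSeq R R (ys.map (fstRingHom R M)) := by
  have := isNoetherianRing_trivSqZeroExt (R := R) (M := M)
  rw [isParameterSeq_iff] at h ⊢
  refine ⟨fun h' => h.1 ?_, fun p hp => ?_⟩
  · rw [smul_eq_mul, Ideal.mul_top] at h' ⊢
    have h1 : (1 : R) ∈ (Ideal.ofList ys).map (fstRingHom R M) := by
      rw [Ideal.map_ofList, h']; trivial
    obtain ⟨w, hw, hw1⟩ :=
      (Ideal.mem_map_iff_of_surjective (fstRingHom R M) fstRingHom_surjective).1 h1
    refine Ideal.eq_top_of_isUnit_mem _ hw (isUnit_iff_isUnit_fst.2 ?_)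
    rw [show w.fst = 1 from hw1]
    exact isUnit_one
  · have hle := le_sup_right.trans (mem_support_quotient_smul_top_iff.1 hp)
    obtain ⟨t, w, htw⟩ := h.2 (PrimeSpectrum.comap (fstRingHom R M) p)
      (mem_support_quotient_smul_top_iff.2 (sup_le (fun a ha => by
        have : a = 0 := by simpa using Module.mem_annihilator.1 ha 1
        rw [this]; exact zero_mem _) (Ideal.span_le.2 fun a ha =>
          hle (Ideal.subset_span (List.mem_map.2 ⟨a, ha, rfl⟩)))))
    by_contra hcon
    simp only [TopNonzeroAt, not_exists, not_forall, not_not] at hcon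
    obtain ⟨s, hs, u, hu⟩ := hcon t (fstRingHom R M w)
    -- Vanishing for the class of `w` holds only up to an error `z` in the square-zero ideal.
    -- Vanishing for the class of `1` at the stage reached removes it: `s' * prod ^ u' - b` lies in
    -- the same ideal, so its product with `z` is zero.
    obtain ⟨s', hs', u', hu'⟩ := hcon (t + u) 1
    rw [smul_eq_mul (a := Ideal.ofList _), Ideal.mul_top] at hu hu'
    obtain ⟨a, ha, hau⟩ := exists_fst_eq_of_mem hu
    obtain ⟨b, hb, hbu⟩ := exists_fst_eq_of_mem hu'
    refine htw (inl (s * s')) (fun hss => (p.2.mem_or_mem (show s * s' ∈ p.asIdeal from hss)).elim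
      hs hs') (u + u') ?_
    rw [smul_eq_mul (a := Ideal.ofList _), Ideal.mul_top]
    rw [← add_assoc]
    set z := inl s * ys.prod ^ u * w - a
    have hz : fstRingHom R M z = 0 := by
      rw [map_sub, hau, map_mul, map_mul, map_pow, map_list_prod, smul_eq_mul, smul_eq_mul,
        ← mul_assoc]
      exact sub_self _
    have hz2 : ∀ c : TrivSqZeroExt R M, fstRingHom R M c = 0 → c * z = 0 := by
      intro c hc
      rw [eq_inr_of_fstRingHom_eq_zero hz, eq_inr_of_fstRingHom_eq_zero hc, inr_mul_inr]
    have hb0 : fstRingHom R M (inl s' * ys.prod ^ u' - b) = 0 := by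
      rw [map_sub, hbu, map_mul, map_pow, map_list_prod, smul_eq_mul, smul_eq_mul, mul_one]
      exact sub_self _
    have h1 : inl s' * ys.prod ^ u' * z = b * z := by
      have h0 := hz2 _ hb0
      rwa [sub_mul, sub_eq_zero] at h0
    have h2 : ys.prod ^ u' * a ∈ Ideal.ofList (ys.map (· ^ (t + u + u'))) := by
      have := list_prod_pow_smul_mem (N := TrivSqZeroExt R M) ys u' (a := t + u) (n := a)
        (by rwa [smul_eq_mul, Ideal.mul_top])
      rwa [smul_eq_mul (a := Ideal.ofList _), Ideal.mul_top] at this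
    have h3 : (inl (s * s') : TrivSqZeroExt R M) • ys.prod ^ (u + u') • w =
        inl s' * (ys.prod ^ u' * a) + b * z := by
      rw [← h1, inl_mul, smul_eq_mul, smul_eq_mul, pow_add]
      ring
    rw [h3]
    exact add_mem (Ideal.mul_mem_left _ _ h2) (Ideal.mul_mem_right _ _ hb)

lemma isStrongParameterSeq_map_inl {rs : List R} (h : IsStrongParameterSeq R R rs) :
    IsStrongParameterSeq (TrivSqZeroExt R M) (TrivSqZeroExt R M) (rs.map inl) := by
  intro i h1 hi
  rw [← List.map_take]
  exact isParameterSeq_map_inl (h i h1 (by simpa using hi))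

lemma isStrongParameterSeq_map_fst {ys : List (TrivSqZeroExt R M)}
    (h : IsStrongParameterSeq (TrivSqZeroExt R M) (TrivSqZeroExt R M) ys) :
    IsStrongParameterSeq R R (ys.map (fstRingHom R M)) := by
  intro i h1 hi
  rw [← List.map_take]
  exact isParameterSeq_map_fst (h i h1 (by simpa using hi))

end TrivialExtension

/-! ### Regular sequences on the trivial extension -/

section Regular

open TrivSqZeroExt

variable {R : Type*} [CommRing R] {M : Type*} [AddCommGroup M] [Module R M] [Module Rᵐᵒᵖ M]
  [IsCentralScalar R M]

lemma isWeaklyRegular_of_map_inl {rs : List R}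
    (h : IsWeaklyRegular (TrivSqZeroExt R M) (rs.map (inl : R → TrivSqZeroExt R M))) :
    IsWeaklyRegular R rs ∧ IsWeaklyRegular M rs := by
  have h' : IsWeaklyRegular (TrivSqZeroExt R M) rs :=
    (isWeaklyRegular_map_algebraMap_iff (S := TrivSqZeroExt R M) _ rs).1 h
  exact ⟨isWeaklyRegular_of_retract (Algebra.linearMap R (TrivSqZeroExt R M))
      (fstHom R R M).toLinearMap (fun a => rfl) h',
    isWeaklyRegular_of_retract (inrHom R M) (sndHom R M) (fun a => rfl) h'⟩

/-- The square zero ideal of the trivial extension is, additively, the module. -/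
def kerFstAddEquiv : RingHom.ker (fstRingHom R M) ≃+ M where
  toFun w := w.1.snd
  invFun m := ⟨inr m, fst_inr R m⟩
  left_inv w := Subtype.ext (eq_inr_of_fstRingHom_eq_zero w.2).symm
  right_inv _ := rfl
  map_add' _ _ := rfl

/-- The extension ring acts on the square-zero ideal and on the quotient by it through the first
coordinate, so weak regularity is inherited from these two pieces. -/
lemma isWeaklyRegular_of_map_fst {ys : List (TrivSqZeroExt R M)}
    (hR : IsWeaklyRegular R (ys.map (fstRingHom R M)))
    (hM : IsWeaklyRegular M (ys.map (fstRingHom R M))) :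
    IsWeaklyRegular (TrivSqZeroExt R M) ys := by
  refine isWeaklyRegular_of_exact (Submodule.injective_subtype (RingHom.ker (fstRingHom R M)))
    (LinearMap.exact_subtype_mkQ _) (Submodule.mkQ_surjective _) ?_ ?_
  · refine (AddEquiv.isWeaklyRegular_congr (e := kerFstAddEquiv) ?_).2 hM
    refine List.forall₂_map_right_iff.mpr (List.forall₂_same.mpr fun r _ w => ?_)
    have hw : w.1.fst = 0 := w.2
    change (r * w.1).snd = r.fst • w.1.snd
    rw [snd_mul, hw]
    simp
  · refine (AddEquiv.isWeaklyRegular_congr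
      (e := (RingHom.quotientKerEquivOfSurjective fstRingHom_surjective).toAddEquiv) ?_).2 hR
    refine List.forall₂_map_right_iff.mpr (List.forall₂_same.mpr fun r _ w => ?_)
    obtain ⟨w, rfl⟩ := Submodule.mkQ_surjective _ w
    exact map_mul (fstRingHom R M) r w

variable [IsNoetherianRing R] [Module.Finite R M]

theorem isCohenMacaulay_of_trivSqZeroExt [IsLocalRing R] [Nontrivial M]
    (h : IsCohenMacaulay (TrivSqZeroExt R M) (TrivSqZeroExt R M)) :
    IsCohenMacaulay R R ∧ ∀ rs : List R, IsRegular R rs → IsRegular M rs := by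
  -- The sequence becomes regular on the extension, which over `R` has both `R` and `M` as retracts.
  have key : ∀ rs : List R, IsStrongParameterSeq R R rs →
      IsWeaklyRegular R rs ∧ IsWeaklyRegular M rs := by
    intro rs hrs
    rcases h _ (isStrongParameterSeq_map_inl (M := M) hrs) with h0 | h0
    · rw [List.map_eq_nil_iff] at h0
      rw [h0]
      exact ⟨.nil R R, .nil R M⟩
    · exact isWeaklyRegular_of_map_inl h0.toIsWeaklyRegular
  refine ⟨fun rs hrs => ?_, fun rs hrs => ?_⟩
  · refine or_iff_not_imp_left.2 fun hne => ⟨(key rs hrs).1, ?_⟩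
    have := (hrs rs.length (List.length_pos_of_ne_nil hne) le_rfl).smul_ne_top
    rw [List.take_length] at this
    exact this.symm
  · exact (isRegular_iff_isWeaklyRegular_of_subset_maximalIdeal
      (mem_maximalIdeal_of_ofList_smul_ne_top hrs.top_ne_smul.symm)).2
      (key rs (isStrongParameterSeq_of_isRegular hrs)).2

theorem isCohenMacaulay_trivSqZeroExt (hR : IsCohenMacaulay R R)
    (hM : ∀ rs : List R, IsRegular R rs → IsRegular M rs) :
    IsCohenMacaulay (TrivSqZeroExt R M) (TrivSqZeroExt R M) := by
  intro ys hys
  refine or_iff_not_imp_left.2 fun hne => ?_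
  have hreg := (hR _ (isStrongParameterSeq_map_fst hys)).resolve_left
    (by rwa [List.map_eq_nil_iff])
  refine ⟨isWeaklyRegular_of_map_fst hreg.toIsWeaklyRegular (hM _ hreg).toIsWeaklyRegular, ?_⟩
  have := (hys ys.length (List.length_pos_of_ne_nil hne) le_rfl).smul_ne_top
  rw [List.take_length] at this
  exact this.symm

end Regular

end TrivExtCM

end

theorem mainTheorem2 {R : Type*} [CommRing R] [IsLocalRing R] [IsNoetherianRing R]
    {M : Type*} [AddCommGroup M] [Module R M] [Module Rᵐᵒᵖ M] [IsCentralScalar R M]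
    [Module.Finite R M] [Nontrivial M] :
    List.TFAE [
      TrivExtCM.IsCohenMacaulay (TrivSqZeroExt R M) (TrivSqZeroExt R M),
      TrivExtCM.IsCohenMacaulay R R ∧
        ∀ rs : List R, RingTheory.Sequence.IsRegular R rs → RingTheory.Sequence.IsRegular M rs,
      TrivExtCM.IsCohenMacaulay R R ∧ TrivExtCM.IsMaximalCohenMacaulay R M] := by
  tfae_have 1 → 2 := TrivExtCM.isCohenMacaulay_of_trivSqZeroExt
  tfae_have 2 → 1 := fun ⟨hR, hM⟩ => TrivExtCM.isCohenMacaulay_trivSqZeroExt hR hM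
  tfae_have 2 → 3 := fun ⟨hR, hM⟩ =>
    ⟨hR, TrivExtCM.isMaximalCohenMacaulay_of_isRegular hR hM⟩
  tfae_have 3 → 2 := fun ⟨hR, hM⟩ =>
    ⟨hR, fun _ hrs => TrivExtCM.isRegular_of_isMaximalCohenMacaulay hM hrs⟩
  tfae_finish
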